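/- Let $P$ be a finite partially ordered set. A linear extension of $P$ is a total order on the elements of $P$ that contains the order of $P$. The linear extension graph $G_L(P)$ has the linear extensions of $P$ as its vertices, and two of them are adjacent if they differ by reversing the order of two consecutive elements. A subgraph of a graph $G$ is convex if it contains all shortest paths of $G$ between its vertices; the convex hull of a set of vertices is the smallest convex subgraph containing it; a hull set of $G$ is a set of vertices whose convex hull is $G$; the hull number of $G$ is the size of a smallest hull set. The dimension of $P$ is the size of a smallest realizer of $P$, i.e. of a smallest non-empty set of linear extensions of $P$ whose intersection is the order of $P$. There are an algorithm (a program of a random access machine with addition and subtraction as its only arithmetic operations, each step at unit cost) and absolute constants $c$ and $C$ such that the following holds. Given any graph $G$ on $n$ vertices $0,\dots,n-1$ (as an adjacency matrix) that is isomorphic to the linear extension graph $G_L(P)$ of some finite poset $P$, the hull number of $G$ equals the dimension of $P$, and the algorithm, with input $G$, outputs this number after at most $C\,n^{c\log n}$ steps. In other words, the hull number of a linear extension graph with $n$ vertices, equivalently the dimension of a poset given by its linear extension graph, can be computed in time $O(n^{c\log n})$. -/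

import Mathlib

/-! ### Geodesic convexity in graphs -/

namespace GraphConvexity

variable {V : Type*} (G : SimpleGraph V)

/-- A subgraph is convex if it contains every shortest path of `G` between two of its vertices. -/
def IsConvex (H : G.Subgraph) : Prop :=
  ∀ u ∈ H.verts, ∀ v ∈ H.verts, ∀ p : G.Walk u v, p.length = G.dist u v → p.toSubgraph ≤ H

/-- The convex hull of a set of vertices: the intersection of all convex subgraphs containing it. -/
noncomputable def convHull (S : Set V) : G.Subgraph :=
  sInf {H | IsConvex G H ∧ S ⊆ H.verts}

/-- A hull set: its convex hull is the whole graph. -/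
def IsHullSet (S : Set V) : Prop :=
  convHull G S = ⊤

/-- The hull number (of a finite graph): the size of a smallest hull set. -/
noncomputable def hullNumber : ℕ :=
  sInf {k | ∃ S : Finset V, IsHullSet G (S : Set V) ∧ S.card = k}

end GraphConvexity

/-! ### Linear extensions, the linear extension graph, and the dimension of a poset -/

/-- A linear extension of a poset: a total order on the same elements containing the given order. -/
structure LinExt (P : Type*) [PartialOrder P] where
  le : P → P → Prop
  le_refl : ∀ x, le x x
  le_trans : ∀ x y z, le x y → le y z → le x z
  le_antisymm : ∀ x y, le x y → le y x → x = y
  le_total : ∀ x y, le x y ∨ le y x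
  extends_le : ∀ x y, x ≤ y → le x y

namespace LinExt

variable {P : Type*} [PartialOrder P]

/-- `x` comes immediately before `y` in `L`. -/
def Consecutive (L : LinExt P) (x y : P) : Prop :=
  x ≠ y ∧ L.le x y ∧ ∀ z, L.le x z → L.le z y → z = x ∨ z = y

/-- `L'` arises from `L` by reversing the order of two consecutive elements of `L`. -/
def NeighborTransposition (L L' : LinExt P) : Prop :=
  ∃ x y, L.Consecutive x y ∧ L'.le y x ∧
    ∀ a b, ¬ (a = x ∧ b = y) → ¬ (a = y ∧ b = x) → (L'.le a b ↔ L.le a b)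

theorem NeighborTransposition.symm {L L' : LinExt P} (h : L.NeighborTransposition L') :
    L'.NeighborTransposition L := by
  obtain ⟨x, y, ⟨hne, hxy, -⟩, hyx, hab⟩ := h
  refine ⟨y, x, ⟨hne.symm, hyx, fun z hyz hzx => ?_⟩, hxy,
    fun a b h1 h2 => (hab a b h2 h1).symm⟩
  by_contra hz
  push Not at hz
  have h1 : L.le y z := (hab y z (fun h => hne h.1.symm) (fun h => hz.2 h.2)).1 hyz
  have h2 : L.le z x := (hab z x (fun h => hz.2 h.1) (fun h => hz.1 h.1)).1 hzx
  exact hne (L.le_antisymm x y hxy (L.le_trans y z x h1 h2))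

theorem NeighborTransposition.irrefl (L : LinExt P) : ¬ L.NeighborTransposition L := by
  rintro ⟨x, y, ⟨hne, hxy, -⟩, hyx, -⟩
  exact hne (L.le_antisymm x y hxy hyx)

end LinExt

/-- The linear extension graph of a poset: the vertices are its linear extensions, and two of them
are adjacent if they differ by reversing two consecutive elements. -/
def linExtGraph (P : Type*) [PartialOrder P] : SimpleGraph (LinExt P) where
  Adj L L' := L.NeighborTransposition L'
  symm := ⟨fun _ _ h => h.symm⟩
  loopless := ⟨LinExt.NeighborTransposition.irrefl⟩

/-- A realizer: a nonempty set of linear extensions whose intersection is the order of `P`. -/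
def IsRealizer {P : Type*} [PartialOrder P] (S : Set (LinExt P)) : Prop :=
  S.Nonempty ∧ ∀ x y : P, x ≤ y ↔ ∀ L ∈ S, L.le x y

/-- The dimension of a (finite) poset: the size of a smallest realizer. -/
noncomputable def posetDim (P : Type*) [PartialOrder P] : ℕ :=
  sInf {k | ∃ S : Finset (LinExt P), IsRealizer (S : Set (LinExt P)) ∧ S.card = k}

/-! ### Random access machines with unit cost

Registers and memory cells hold natural numbers.  Addition and truncated subtraction are the only
arithmetic, so that step counts agree with those of Turing machines up to a polynomial. -/

namespace RAM

/-- The instructions; `r s t` are register names, `k` a constant, `l` a program line. -/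
inductive Instr where
  /-- `reg r := k` -/
  | const (r k : ℕ)
  /-- `reg r := reg s` -/
  | move (r s : ℕ)
  /-- `reg r := reg s + reg t` -/
  | add (r s t : ℕ)
  /-- `reg r := max (reg s - reg t) 0` -/
  | sub (r s t : ℕ)
  /-- `reg r := mem (reg s)` -/
  | load (r s : ℕ)
  /-- `mem (reg r) := reg s` -/
  | store (r s : ℕ)
  /-- go to line `l` -/
  | jump (l : ℕ)
  /-- go to line `l` if `reg r = 0` -/
  | jumpZero (r l : ℕ)

/-- A program is a finite list of instructions. -/
abbrev Program := List Instr

/-- A configuration: program counter, registers, memory. -/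
structure Config where
  pc : ℕ
  reg : ℕ → ℕ
  mem : ℕ → ℕ

/-- The effect of a single instruction. -/
def Instr.exec (c : Config) : Instr → Config
  | const r k => ⟨c.pc + 1, Function.update c.reg r k, c.mem⟩
  | move r s => ⟨c.pc + 1, Function.update c.reg r (c.reg s), c.mem⟩
  | add r s t => ⟨c.pc + 1, Function.update c.reg r (c.reg s + c.reg t), c.mem⟩
  | sub r s t => ⟨c.pc + 1, Function.update c.reg r (c.reg s - c.reg t), c.mem⟩
  | load r s => ⟨c.pc + 1, Function.update c.reg r (c.mem (c.reg s)), c.mem⟩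
  | store r s => ⟨c.pc + 1, c.reg, Function.update c.mem (c.reg r) (c.reg s)⟩
  | jump l => ⟨l, c.reg, c.mem⟩
  | jumpZero r l => ⟨if c.reg r = 0 then l else c.pc + 1, c.reg, c.mem⟩

/-- One step of the machine: execute the instruction in line `pc`. A configuration whose program
counter points outside the program is halted and stays as it is. -/
def step (p : Program) (c : Config) : Config :=
  match p[c.pc]? with
  | some i => i.exec c
  | none => c

/-- Started in `c`, the program halts after at most `T` steps with `out` in register `0`. -/
def OutputsWithin (p : Program) (c : Config) (out : ℕ) (T : ℝ) : Prop :=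
  ∃ k : ℕ, (k : ℝ) ≤ T ∧ p.length ≤ ((step p)^[k] c).pc ∧ ((step p)^[k] c).reg 0 = out

open Classical in
/-- The initial configuration for a graph with vertices `0, …, n - 1`: register `0` holds `n`, the
memory holds the adjacency matrix row by row, everything else is `0`. -/
noncomputable def graphInput {n : ℕ} (G : SimpleGraph (Fin n)) : Config where
  pc := 0
  reg := Function.update (fun _ => 0) 0 n
  mem a := if ∃ i j : Fin n, a = i.val * n + j.val ∧ G.Adj i j then 1 else 0

end RAM

/-!
A linear extension is encoded by the set of pairs it orders. Moving along an edge of the linear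
extension graph reverses one pair, and if `L ≠ M` then `M` reverses some consecutive pair of `L`,
so a first step towards `M` always exists. Hence distances count inversions
(`LinExt.inversions_eq_dist`), and deleting the edges that flip `x` and `y` leaves two sides: the
linear extensions with `x` below `y` and those with `y` below `x`. These sides are convex, so a hull
set meets the two sides of every edge. This forces it to be a realizer, and conversely a convex set
containing a realizer is everything: its element closest to a given linear extension could otherwise
be moved one step closer (`LinExt.isHullSet_of_isRealizer`). Thus hull sets, realizers, and nonempty
vertex sets `S` such that each oriented edge `(a, b)` has an `s ∈ S` with `d(s, a) < d(s, b)` are the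
same (`GraphConvexity.isHullSet_iff_coversEdges`), and the hull number equals the dimension.

The last description turns the hull number into the size of a smallest cover, which the program finds
by exhaustive search. It computes all distances and then tries the lists of vertices in order of
increasing length, represented by the numbers `1, 2, 3, …` in bijective base `n`, until one covers
all oriented edges (`RAM.HullProgram.exists_first_covering`). If the hull number is `k`, this takes
`O((n + 1) ^ (5 * k))` steps.

The search is quasi-polynomial since `k ≤ 1 + log₂ n` (`LinExt.two_pow_posetDim_le_card`). By
Dilworth's theorem the poset is covered by `w` chains, where `w` is the size of an antichain; placing
each of the chains above everything incomparable to it gives a realizer of size `w`. On the other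
hand, fixing an element `a` of the antichain, each of its other `w - 1` elements can independently be
put below or above `a`, so that there are at least `2 ^ (w - 1)` linear extensions.

The program is written in a small structured language. Its compiler to the random access machine is
proved correct, with exact step counts, in `RAM.Cmd.Runs.represents`.
-/

/-! ### Geodesic convexity in terms of distances -/

namespace GraphConvexity

variable {V W : Type*}

/-- A set of vertices is geodesically closed if it contains every vertex lying on a shortest path
between two of its members. -/
def GeodesicallyClosed (G : SimpleGraph V) (C : Set V) : Prop :=
  ∀ u ∈ C, ∀ v ∈ C, ∀ w, G.dist u w + G.dist w v = G.dist u v → w ∈ C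

/-- In a connected graph a convex subgraph is determined by its vertex set, so convexity may be
tested on vertex sets, using distances only. -/
theorem isHullSet_iff_geodesicallyClosed {G : SimpleGraph V} (hG : G.Connected) (S : Set V) :
    IsHullSet G S ↔ ∀ C, GeodesicallyClosed G C → S ⊆ C → C = Set.univ := by
  have key : IsHullSet G S ↔ ∀ H : G.Subgraph, IsConvex G H → S ⊆ H.verts → H = ⊤ := by
    simp [IsHullSet, convHull, sInf_eq_top]
  rw [key]
  constructor
  · intro h C hC hS
    have hconv : IsConvex G ((⊤ : G.Subgraph).induce C) := by
      intro u hu v hv p hp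
      have hsupp : ∀ w ∈ p.support, w ∈ C := by
        intro w hw
        classical
        refine hC u hu v hv w (le_antisymm ?_ hG.dist_triangle)
        have h1 := SimpleGraph.dist_le (p.takeUntil w hw)
        have h2 := SimpleGraph.dist_le (p.dropUntil w hw)
        have h3 := congrArg SimpleGraph.Walk.length (p.take_spec hw)
        rw [SimpleGraph.Walk.length_append] at h3
        omega
      refine ⟨fun w hw => hsupp w (by simpa using hw), fun a b hab => ?_⟩
      have ha := hsupp a (by simpa using p.toSubgraph.edge_vert hab)
      have hb := hsupp b (by simpa using p.toSubgraph.edge_vert hab.symm)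
      simpa [SimpleGraph.Subgraph.induce_adj, ha, hb] using hab.adj_sub
    have := h _ hconv (by simpa using hS)
    simpa using congrArg SimpleGraph.Subgraph.verts this
  · intro h H hH hS
    have hverts : H.verts = Set.univ := by
      refine h _ ?_ hS
      intro u hu v hv w hw
      obtain ⟨p, hp⟩ := hG.exists_walk_length_eq_dist u w
      obtain ⟨q, hq⟩ := hG.exists_walk_length_eq_dist w v
      have := hH u hu v hv (p.append q) (by rw [SimpleGraph.Walk.length_append]; omega)
      exact this.1 (by simp)
    refine le_antisymm le_top ⟨by simp [hverts], fun a b hab => ?_⟩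
    have hab' : G.Adj a b := by simpa using hab
    have := hH a (by simp [hverts]) b (by simp [hverts]) hab'.toWalk
      (by simp [SimpleGraph.dist_eq_one_iff_adj.2 hab'])
    exact this.2 (by simp)

theorem dist_iso {G : SimpleGraph V} {G' : SimpleGraph W} (φ : G ≃g G') (hG : G.Connected)
    (u v : V) : G'.dist (φ u) (φ v) = G.dist u v := by
  have hG' : G'.Connected := φ.connected_iff.1 hG
  apply le_antisymm
  · obtain ⟨p, hp⟩ := hG.exists_walk_length_eq_dist u v
    rw [← hp, ← SimpleGraph.Walk.length_map φ.toHom p]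
    exact SimpleGraph.dist_le _
  · obtain ⟨p, hp⟩ := hG'.exists_walk_length_eq_dist (φ u) (φ v)
    rw [← hp, ← SimpleGraph.Walk.length_map φ.symm.toHom p]
    have := SimpleGraph.dist_le (p.map φ.symm.toHom)
    simpa using this

end GraphConvexity

/-! ### Distances in the linear extension graph -/

namespace LinExt

variable {P : Type*} [PartialOrder P]

theorem ext_le {L M : LinExt P} (h : ∀ x y, L.le x y ↔ M.le x y) : L = M := by
  cases L; cases M
  simp only [mk.injEq]
  funext x y
  exact propext (h x y)

instance [Finite P] : Finite (LinExt P) :=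
  Finite.of_injective (fun L : LinExt P => L.le) fun L _ h =>
    ext_le fun x y => by rw [show L.le = _ from h]

/-- `L'` arises from `L` by moving `y`, which comes immediately after `x` in `L`, before `x`. -/
def Flips (L L' : LinExt P) (x y : P) : Prop :=
  L.Consecutive x y ∧ L'.le y x ∧
    ∀ a b, ¬ (a = x ∧ b = y) → ¬ (a = y ∧ b = x) → (L'.le a b ↔ L.le a b)

theorem Flips.symm {L L' : LinExt P} {x y : P} (h : L.Flips L' x y) : L'.Flips L y x := by
  obtain ⟨⟨hne, hxy, -⟩, hyx, hab⟩ := h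
  refine ⟨⟨hne.symm, hyx, fun z hyz hzx => ?_⟩, hxy,
    fun a b h1 h2 => (hab a b h2 h1).symm⟩
  by_contra hz
  push Not at hz
  have h1 : L.le y z := (hab y z (fun h => hne h.1.symm) (fun h => hz.2 h.2)).1 hyz
  have h2 : L.le z x := (hab z x (fun h => hz.2 h.1) (fun h => hz.1 h.1)).1 hzx
  exact hne (L.le_antisymm x y hxy (L.le_trans y z x h1 h2))

/-- The inversions from `L` to `M`: the pairs ordered by `L` but not by `M`. -/
def inversions (L M : LinExt P) : Set (P × P) :=
  {p | L.le p.1 p.2 ∧ ¬ M.le p.1 p.2}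

theorem ncard_inversions_of_flips [Finite P] {L L' M : LinExt P} {x y : P}
    (h : L.Flips L' x y) (hM : M.le y x) :
    (inversions L M).ncard = (inversions L' M).ncard + 1 := by
  obtain ⟨⟨hne, hxy, -⟩, hyx, hab⟩ := h
  have hL' : ¬ L'.le x y := fun h => hne (L'.le_antisymm _ _ h hyx)
  have hM' : ¬ M.le x y := fun h => hne (M.le_antisymm _ _ h hM)
  have : inversions L M = insert (x, y) (inversions L' M) := by
    ext ⟨a, b⟩
    simp only [inversions, Set.mem_ofPred_eq, Set.mem_insert_iff, Prod.mk.injEq]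
    by_cases h1 : a = x ∧ b = y
    · simp [h1.1, h1.2, hxy, hM']
    by_cases h2 : a = y ∧ b = x
    · simp [h2.1, h2.2, hM, hne.symm]
    rw [hab a b h1 h2]
    tauto
  rw [this, Set.ncard_insert_of_notMem (by simp [inversions, hL']) (Set.toFinite _)]

/-- The linear extension obtained by reversing two consecutive elements that are not comparable
in `P`. -/
def swap (L : LinExt P) (x y : P) (h : L.Consecutive x y) (hxy : ¬ x ≤ y) : LinExt P where
  le a b := (L.le a b ∧ ¬ (a = x ∧ b = y)) ∨ (a = y ∧ b = x)
  le_refl a := Or.inl ⟨L.le_refl a, fun h' => h.1 (h'.1.symm.trans h'.2)⟩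
  le_trans a b c hab hbc := by
    obtain ⟨hne, hle, hcons⟩ := h
    have := L.le_trans
    have := L.le_antisymm
    have := L.le_total
    have := L.le_refl
    grind
  le_antisymm a b hab hba := by
    obtain ⟨hne, hle, hcons⟩ := h
    have := L.le_antisymm
    grind
  le_total a b := by
    have := L.le_total a b
    grind
  extends_le a b hab := Or.inl ⟨L.extends_le a b hab, fun h' => hxy (h'.1 ▸ h'.2 ▸ hab)⟩

theorem flips_swap (L : LinExt P) (x y : P) (h : L.Consecutive x y) (hxy : ¬ x ≤ y) :
    L.Flips (L.swap x y h hxy) x y :=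
  ⟨h, Or.inr ⟨rfl, rfl⟩, fun a b h1 h2 => by simp only [swap]; tauto⟩

/-- A step towards `M`: if `M` reverses some pair of `L`, then it reverses a consecutive pair. The
pair is one whose interval in `L` is smallest. -/
theorem exists_consecutive_of_ne [Finite P] {L M : LinExt P} (h : L ≠ M) :
    ∃ x y, L.Consecutive x y ∧ M.le y x := by
  have hne : (inversions L M).Nonempty := by
    by_contra hemp
    rw [Set.not_nonempty_iff_eq_empty] at hemp
    have hsub : ∀ x y, L.le x y → M.le x y := by
      intro x y hxy
      by_contra hc
      have : (x, y) ∈ inversions L M := ⟨hxy, hc⟩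
      simp [hemp] at this
    refine h (ext_le fun x y => ⟨hsub x y, fun hxy => ?_⟩)
    rcases L.le_total x y with h1 | h1
    · exact h1
    · rw [M.le_antisymm x y hxy (hsub y x h1)]
      exact L.le_refl y
  obtain ⟨⟨x, y⟩, ⟨hxy, hM⟩, hmin⟩ :=
    (Set.toFinite (inversions L M)).exists_minimalFor
      (fun p => {z | L.le p.1 z ∧ L.le z p.2}.ncard) _ hne
  simp only at hxy hM hmin
  have hyx : M.le y x := (M.le_total x y).resolve_left hM
  refine ⟨x, y, ⟨fun h => hM (h ▸ M.le_refl x), hxy, fun z hxz hzy => ?_⟩, hyx⟩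
  by_contra hz
  push Not at hz
  by_cases hxz' : M.le x z
  · have hzy' : ¬ M.le z y := fun h' => hM (M.le_trans _ _ _ hxz' h')
    have hlt : {w | L.le z w ∧ L.le w y}.ncard < {w | L.le x w ∧ L.le w y}.ncard := by
      refine Set.ncard_lt_ncard ⟨fun w hw => ⟨L.le_trans _ _ _ hxz hw.1, hw.2⟩, fun hc => ?_⟩
        (Set.toFinite _)
      exact hz.1 (L.le_antisymm _ _ (hc ⟨L.le_refl x, hxy⟩).1 hxz)
    have := hmin (j := (z, y)) ⟨hzy, hzy'⟩ hlt.le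
    exact absurd this (not_le.2 hlt)
  · have hlt : {w | L.le x w ∧ L.le w z}.ncard < {w | L.le x w ∧ L.le w y}.ncard := by
      refine Set.ncard_lt_ncard ⟨fun w hw => ⟨hw.1, L.le_trans _ _ _ hw.2 hzy⟩, fun hc => ?_⟩
        (Set.toFinite _)
      exact hz.2 (L.le_antisymm _ _ hzy (hc ⟨hxy, L.le_refl y⟩).2)
    have := hmin (j := (x, z)) ⟨hxz, hxz'⟩ hlt.le
    exact absurd this (not_le.2 hlt)

theorem inversions_self (L : LinExt P) : inversions L L = ∅ := by
  ext; simp [inversions]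

theorem exists_walk_length_eq_inversions [Finite P] (M : LinExt P) (k : ℕ) (L : LinExt P)
    (h : (inversions L M).ncard = k) : ∃ p : (linExtGraph P).Walk L M, p.length = k := by
  induction k generalizing L with
  | zero =>
    have : L = M := by
      by_contra hne
      obtain ⟨x, y, hc, hyx⟩ := exists_consecutive_of_ne hne
      have hmem : (x, y) ∈ inversions L M := ⟨hc.2.1, fun h' => hc.1 (M.le_antisymm _ _ h' hyx)⟩
      rw [Set.ncard_eq_zero] at h
      simp [h] at hmem
    subst this
    exact ⟨.nil, rfl⟩
  | succ k ih =>
    have hne : L ≠ M := by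
      rintro rfl
      simp [inversions_self] at h
    obtain ⟨x, y, hc, hyx⟩ := exists_consecutive_of_ne hne
    have hxy : ¬ x ≤ y := fun h' => hc.1 (M.le_antisymm _ _ (M.extends_le _ _ h') hyx)
    have hf := flips_swap L x y hc hxy
    have hcard := ncard_inversions_of_flips hf hyx
    obtain ⟨p, hp⟩ := ih (L.swap x y hc hxy) (by omega)
    have hadj : (linExtGraph P).Adj L (L.swap x y hc hxy) := ⟨x, y, hf⟩
    exact ⟨.cons hadj p, by simp [hp]⟩

theorem inversions_le_length [Finite P] {L M : LinExt P} (p : (linExtGraph P).Walk L M) :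
    (inversions L M).ncard ≤ p.length := by
  induction p with
  | nil => simp [inversions_self]
  | @cons L L' M h p ih =>
    rw [SimpleGraph.Walk.length_cons]
    obtain ⟨x, y, hf⟩ := h
    have hf : L.Flips L' x y := hf
    rcases M.le_total x y with h1 | h1
    · have := ncard_inversions_of_flips hf.symm h1
      omega
    · have := ncard_inversions_of_flips hf h1
      omega

theorem inversions_eq_dist [Finite P] (L M : LinExt P) :
    (linExtGraph P).dist L M = (inversions L M).ncard := by
  obtain ⟨p, hp⟩ := exists_walk_length_eq_inversions M _ L rfl
  refine _root_.le_antisymm (hp ▸ SimpleGraph.dist_le p) ?_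
  obtain ⟨q, hq⟩ := p.reachable.exists_walk_length_eq_dist
  exact hq ▸ inversions_le_length q

/-- Any partial order extending that of `P` is contained in a linear extension of `P`. -/
theorem exists_of_extension (r : P → P → Prop) (hr : IsPartialOrder P r)
    (h : ∀ x y, x ≤ y → r x y) : ∃ L : LinExt P, ∀ x y, r x y → L.le x y := by
  obtain ⟨s, hs, hrs⟩ := extend_partialOrder r
  exact ⟨⟨s, fun x => hs.refl x, fun x y z => hs.trans x y z, fun x y => hs.antisymm x y,
    fun x y => hs.total x y, fun x y hxy => hrs x y (h x y hxy)⟩, hrs⟩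

/-- A monotone map sorts the elements of `P`: some linear extension is compatible with it. It is
obtained by extending the lexicographic order "first by `g`, then by `P`". -/
theorem exists_of_monotone {β : Type*} [PartialOrder β] (g : P → β) (hg : Monotone g) :
    ∃ L : LinExt P, ∀ x y, g x < g y → L.le x y := by
  obtain ⟨L, hL⟩ := exists_of_extension (fun x y => g x < g y ∨ (g x = g y ∧ x ≤ y))
    { refl := fun x => Or.inr ⟨rfl, _root_.le_refl x⟩
      trans := by
        rintro x y z (h1 | ⟨h1, h1'⟩) (h2 | ⟨h2, h2'⟩)
        · exact Or.inl (h1.trans h2)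
        · exact Or.inl (h2 ▸ h1)
        · exact Or.inl (h1 ▸ h2)
        · exact Or.inr ⟨h1.trans h2, h1'.trans h2'⟩
      antisymm := by
        rintro x y (h1 | ⟨h1, h1'⟩) (h2 | ⟨h2, h2'⟩)
        · exact absurd h2 h1.asymm
        · exact absurd h2 h1.ne'
        · exact absurd h1 h2.ne'
        · exact _root_.le_antisymm h1' h2' }
    (fun x y hxy => (hg hxy).lt_or_eq.imp_right fun h => ⟨h, hxy⟩)
  exact ⟨L, fun x y h => hL x y (Or.inl h)⟩

instance : Nonempty (LinExt P) :=
  (exists_of_monotone (fun _ : P => ()) monotone_const).nonempty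

theorem exists_le_of_not_le {x y : P} (h : ¬ x ≤ y) : ∃ L : LinExt P, L.le y x ∧ x ≠ y := by
  obtain ⟨L, hL⟩ := exists_of_monotone (fun z : P => x ≤ z) fun a b hab h' => _root_.le_trans h' hab
  refine ⟨L, hL y x ?_, fun h' => h (h' ▸ _root_.le_refl x)⟩
  simp [lt_iff_le_not_ge, h]

end LinExt

theorem linExtGraph_connected (P : Type*) [PartialOrder P] [Finite P] :
    (linExtGraph P).Connected :=
  { preconnected := fun L M => by
      obtain ⟨p, -⟩ := LinExt.exists_walk_length_eq_inversions M _ L rfl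
      exact p.reachable
    nonempty := inferInstance }

/-! ### Hull sets are realizers -/

namespace GraphConvexity

variable {V : Type*}

/-- Every oriented edge `(a, b)` has an element of `S` on the side of `a`. -/
def CoversEdges (G : SimpleGraph V) (S : Set V) : Prop :=
  ∀ a b, G.Adj a b → ∃ s ∈ S, G.dist s a < G.dist s b

end GraphConvexity

namespace LinExt

open GraphConvexity

variable {P : Type*} [PartialOrder P] [Finite P]

/-- The linear extensions closer to `L` than to `L'` are those which order the flipped pair as `L`
does. -/
theorem dist_lt_dist_iff_of_flips {L L' : LinExt P} {x y : P} (h : L.Flips L' x y)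
    (M : LinExt P) : (linExtGraph P).dist M L < (linExtGraph P).dist M L' ↔ M.le x y := by
  rw [SimpleGraph.dist_comm, SimpleGraph.dist_comm (u := M), inversions_eq_dist,
    inversions_eq_dist]
  constructor
  · intro hlt
    by_contra hc
    have := ncard_inversions_of_flips h ((M.le_total x y).resolve_left hc)
    omega
  · intro hM
    have := ncard_inversions_of_flips h.symm hM
    omega

theorem geodesicallyClosed_setOf_le (x y : P) :
    GeodesicallyClosed (linExtGraph P) {L | L.le x y} := by
  intro L hL M hM N hN
  by_contra hc
  simp only [inversions_eq_dist, Set.mem_ofPred_eq] at hN hL hM hc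
  -- the pair `(x, y)` is inverted on the way to `N` and back again, so `N` is not on a geodesic
  have hlt : (inversions L M).ncard < (inversions L N ∪ inversions N M).ncard := by
    refine Set.ncard_lt_ncard ⟨?_, fun h => ?_⟩ (Set.toFinite _)
    · rintro p ⟨h1, h2⟩
      by_cases h3 : N.le p.1 p.2
      · exact Or.inr ⟨h3, h2⟩
      · exact Or.inl ⟨h1, h3⟩
    · exact (h (a := (x, y)) (Or.inl ⟨hL, hc⟩)).2 hM
  have := Set.ncard_union_le (inversions L N) (inversions N M)
  omega

theorem coversEdges_of_isHullSet {S : Set (LinExt P)} (h : IsHullSet (linExtGraph P) S) :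
    CoversEdges (linExtGraph P) S := by
  rw [isHullSet_iff_geodesicallyClosed (linExtGraph_connected P)] at h
  rintro L L' ⟨x, y, hf⟩
  have hf : L.Flips L' x y := hf
  by_contra! hc
  have hS : S ⊆ {M | M.le y x} := fun M hM =>
    (M.le_total x y).resolve_left fun h' =>
      absurd ((dist_lt_dist_iff_of_flips hf M).2 h') (not_lt.2 (hc M hM))
  have huniv := h _ (geodesicallyClosed_setOf_le y x) hS
  have hL : L.le y x := by
    have : L ∈ {M : LinExt P | M.le y x} := huniv ▸ Set.mem_univ L
    exact this
  exact hf.1.1 (L.le_antisymm _ _ hf.1.2.1 hL)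

theorem isRealizer_of_coversEdges {S : Set (LinExt P)} (hne : S.Nonempty)
    (h : CoversEdges (linExtGraph P) S) : IsRealizer S := by
  refine ⟨hne, fun x y => ⟨fun hxy L _ => L.extends_le x y hxy, fun hS => ?_⟩⟩
  by_contra hxy
  obtain ⟨M, hM, hne'⟩ := exists_le_of_not_le hxy
  obtain ⟨L, hL⟩ := hne
  -- some edge on a path from `M`, where `y` is below `x`, to `L` flips `y` and `x`
  obtain ⟨p⟩ := (linExtGraph_connected P).preconnected M L
  obtain ⟨d, -, h1, h2⟩ := p.exists_boundary_dart {N | N.le y x} hM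
    (fun h' => hne' (L.le_antisymm _ _ (hS L hL) h'))
  obtain ⟨a, b, hf⟩ := d.adj
  have hf : d.fst.Flips d.snd a b := hf
  have hab : y = a ∧ x = b := by
    by_contra hc
    by_cases hc' : y = b ∧ x = a
    · exact h2 (hc'.1 ▸ hc'.2 ▸ hf.2.1)
    · exact h2 ((hf.2.2 y x hc hc').2 h1)
  obtain ⟨rfl, rfl⟩ := hab
  obtain ⟨N, hN, hlt⟩ := h _ _ d.adj
  rw [dist_lt_dist_iff_of_flips hf] at hlt
  exact hne' (N.le_antisymm _ _ (hS N hN) hlt)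

/-- In a geodesically closed set containing a realizer, consider an element `L` closest to a given
linear extension `M`. If `L ≠ M`, then `M` reverses a consecutive pair of `L`, some element of the
realizer does so too, and the swap of this pair lies between the two and is closer to `M`. -/
theorem isHullSet_of_isRealizer {S : Set (LinExt P)} (h : IsRealizer S) :
    IsHullSet (linExtGraph P) S := by
  rw [isHullSet_iff_geodesicallyClosed (linExtGraph_connected P)]
  intro C hC hS
  refine Set.eq_univ_of_forall fun M => ?_
  obtain ⟨L, hL, hmin⟩ := (Set.toFinite C).exists_minimalFor
    (fun L => (inversions L M).ncard) _ (h.1.mono hS)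
  by_contra hM
  have hne : L ≠ M := fun h' => hM (h' ▸ hL)
  obtain ⟨x, y, hc, hyx⟩ := exists_consecutive_of_ne hne
  have hxy : ¬ x ≤ y := fun h' => hc.1 (M.le_antisymm _ _ (M.extends_le _ _ h') hyx)
  have hf := flips_swap L x y hc hxy
  obtain ⟨N, hN, hNxy⟩ : ∃ N ∈ S, ¬ N.le x y := by
    by_contra! hall
    exact hxy ((h.2 x y).2 hall)
  have h1 := ncard_inversions_of_flips hf ((N.le_total x y).resolve_left hNxy)
  have h2 := ncard_inversions_of_flips hf hyx
  have h3 : (linExtGraph P).dist L (L.swap x y hc hxy) = 1 :=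
    SimpleGraph.dist_eq_one_iff_adj.2 ⟨x, y, hf⟩
  have hmem := hC L hL N (hS hN) (L.swap x y hc hxy)
    (by rw [h3, inversions_eq_dist, inversions_eq_dist]; omega)
  have := hmin hmem (by simp only; omega)
  simp only at this
  omega

theorem isHullSet_iff_isRealizer (S : Set (LinExt P)) :
    IsHullSet (linExtGraph P) S ↔ IsRealizer S := by
  refine ⟨fun h => isRealizer_of_coversEdges ?_ (coversEdges_of_isHullSet h),
    isHullSet_of_isRealizer⟩
  rw [isHullSet_iff_geodesicallyClosed (linExtGraph_connected P)] at h
  by_contra hS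
  rw [Set.not_nonempty_iff_eq_empty] at hS
  exact Set.empty_ne_univ (h ∅ (by simp [GeodesicallyClosed]) hS.subset)

end LinExt

namespace GraphConvexity

variable {V : Type*} {P : Type*} [PartialOrder P] [Finite P] {G : SimpleGraph V}

theorem connected_of_iso (φ : G ≃g linExtGraph P) : G.Connected :=
  φ.connected_iff.2 (linExtGraph_connected P)

theorem isHullSet_iff_isRealizer_image (φ : G ≃g linExtGraph P) (S : Set V) :
    IsHullSet G S ↔ IsRealizer (φ '' S) := by
  have hG := connected_of_iso φ
  rw [← LinExt.isHullSet_iff_isRealizer, isHullSet_iff_geodesicallyClosed hG,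
    isHullSet_iff_geodesicallyClosed (linExtGraph_connected P)]
  constructor
  · intro h C hC hS
    have := h (φ ⁻¹' C) (fun u hu v hv w hw => hC _ hu _ hv _ (by simpa only [dist_iso φ hG]))
      (Set.image_subset_iff.1 hS)
    exact Set.eq_univ_of_forall fun L => by
      simpa using this.ge (Set.mem_univ (φ.symm L))
  · intro h C hC hS
    have := h (φ '' C) ?_ (Set.image_mono hS)
    · exact Set.eq_univ_of_forall fun v => by
        simpa using this.ge (Set.mem_univ (φ v))
    · rintro _ ⟨u, hu, rfl⟩ _ ⟨v, hv, rfl⟩ L hL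
      obtain ⟨w, rfl⟩ := φ.surjective L
      simp only [dist_iso φ hG] at hL
      exact ⟨w, hC u hu v hv w hL, rfl⟩

theorem isHullSet_iff_coversEdges (φ : G ≃g linExtGraph P) (S : Set V) :
    IsHullSet G S ↔ S.Nonempty ∧ CoversEdges G S := by
  have hG := connected_of_iso φ
  have hcov : CoversEdges G S ↔ CoversEdges (linExtGraph P) (φ '' S) := by
    constructor
    · intro h L L' hadj
      obtain ⟨a, rfl⟩ := φ.surjective L
      obtain ⟨b, rfl⟩ := φ.surjective L'
      obtain ⟨s, hs, hlt⟩ := h a b (φ.map_adj_iff.1 hadj)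
      exact ⟨φ s, ⟨s, hs, rfl⟩, by simpa only [dist_iso φ hG]⟩
    · intro h a b hadj
      obtain ⟨_, ⟨s, hs, rfl⟩, hlt⟩ := h (φ a) (φ b) (φ.map_adj_iff.2 hadj)
      exact ⟨s, hs, by simpa only [dist_iso φ hG] using hlt⟩
  rw [isHullSet_iff_isRealizer_image φ, hcov]
  constructor
  · intro h
    exact ⟨by simpa using h.1, LinExt.coversEdges_of_isHullSet
      ((LinExt.isHullSet_iff_isRealizer _).2 h)⟩
  · rintro ⟨h1, h2⟩
    exact LinExt.isRealizer_of_coversEdges (h1.image _) h2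

theorem hullNumber_eq_posetDim (φ : G ≃g linExtGraph P) : hullNumber G = posetDim P := by
  unfold hullNumber posetDim
  congr 1
  ext k
  constructor
  · rintro ⟨S, hS, rfl⟩
    refine ⟨S.map φ.toEquiv.toEmbedding, ?_, by simp⟩
    simpa using (isHullSet_iff_isRealizer_image φ _).1 hS
  · rintro ⟨S, hS, rfl⟩
    refine ⟨S.map φ.symm.toEquiv.toEmbedding, ?_, by simp⟩
    rw [isHullSet_iff_isRealizer_image φ]
    convert hS
    ext L
    simp [Set.mem_image]

end GraphConvexity

/-! ### Dilworth's theorem and the number of linear extensions -/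

/-- **Dilworth's theorem**: every finite subset `s` of a partial order contains an antichain `t` such
that `s` can be partitioned into `#t` chains, the classes of a colouring `f`. -/
theorem exists_isAntichain_chain_partition {α : Type*} [PartialOrder α] (s : Finset α) :
    ∃ t ⊆ s, IsAntichain (· ≤ ·) (t : Set α) ∧ ∃ f : α → ℕ, (∀ x ∈ s, f x < t.card) ∧
      ∀ x ∈ s, ∀ y ∈ s, f x = f y → x ≤ y ∨ y ≤ x := by
  classical
  induction s using Finset.strongInduction with
  | H s ih =>
  rcases s.eq_empty_or_nonempty with rfl | hs
  · exact ⟨∅, by simp, by simp, fun _ => 0, by simp, by simp⟩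
  obtain ⟨a, ha⟩ := s.exists_maximal hs
  obtain ⟨t₀, ht₀, hanti₀, f₀, hlt₀, hchain₀⟩ := ih (s.erase a) (Finset.erase_ssubset ha.1)
  -- every antichain of maximal size meets every chain
  have hit : ∀ t ⊆ s.erase a, IsAntichain (· ≤ ·) (t : Set α) → t₀.card ≤ t.card →
      ∀ c < t₀.card, ∃ x ∈ t, f₀ x = c := by
    intro t ht hanti hcard c hc
    have hinj : Set.InjOn f₀ t := by
      intro x hx y hy hxy
      by_contra hne
      rcases hchain₀ x (ht hx) y (ht hy) hxy with h | h
      · exact hanti hx hy hne h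
      · exact hanti hy hx (Ne.symm hne) h
    have himg : t.image f₀ = Finset.range t₀.card := by
      apply Finset.eq_of_subset_of_card_le
      · intro k hk
        obtain ⟨x, hx, rfl⟩ := Finset.mem_image.1 hk
        exact Finset.mem_range.2 (hlt₀ x (ht hx))
      · rwa [Finset.card_range, Finset.card_image_of_injOn hinj]
    have : c ∈ t.image f₀ := himg ▸ Finset.mem_range.2 hc
    simpa using this
  -- in each chain, `top c` is the largest element lying in an antichain of maximal size
  have htop : ∀ c, ∃ x, c < t₀.card → (x ∈ s.erase a ∧ f₀ x = c ∧
      (∃ t ⊆ s.erase a, IsAntichain (· ≤ ·) (t : Set α) ∧ t₀.card ≤ t.card ∧ x ∈ t) ∧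
      ∀ t ⊆ s.erase a, IsAntichain (· ≤ ·) (t : Set α) → t₀.card ≤ t.card →
        ∀ y ∈ t, f₀ y = c → y ≤ x) := by
    intro c
    by_cases hc : c < t₀.card
    · let m := (s.erase a).filter fun x => f₀ x = c ∧
        ∃ t ⊆ s.erase a, IsAntichain (· ≤ ·) (t : Set α) ∧ t₀.card ≤ t.card ∧ x ∈ t
      have hm : m.Nonempty := by
        obtain ⟨x, hx, hxc⟩ := hit t₀ ht₀ hanti₀ le_rfl c hc
        exact ⟨x, Finset.mem_filter.2 ⟨ht₀ hx, hxc, t₀, ht₀, hanti₀, le_rfl, hx⟩⟩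
      obtain ⟨x, hx⟩ := m.exists_maximal hm
      obtain ⟨hxs, hxc, hxt⟩ := Finset.mem_filter.1 hx.1
      refine ⟨x, fun _ => ⟨hxs, hxc, hxt, fun t ht hanti hcard y hy hyc => ?_⟩⟩
      have hym : y ∈ m := Finset.mem_filter.2 ⟨ht hy, hyc, t, ht, hanti, hcard, hy⟩
      rcases hchain₀ x hxs y (ht hy) (hxc.trans hyc.symm) with h | h
      · exact hx.2 hym h
      · exact h
    · exact ⟨a, fun h => absurd h hc⟩
  choose top htop using htop
  by_cases hcase : ∃ c < t₀.card, top c ≤ a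
  · -- the part of the chain up to `top c`, together with `a`, is a chain meeting every antichain
    -- of maximal size
    obtain ⟨c, hc, hca⟩ := hcase
    obtain ⟨hts, htc, -, hmax⟩ := htop c hc
    let K := s.filter fun z => z = a ∨ (f₀ z = c ∧ z ≤ top c)
    have hK : ∀ x ∈ s, x ∉ s \ K → x = a ∨ (f₀ x = c ∧ x ≤ top c) := by
      intro x hx hxK
      by_contra h
      exact hxK (Finset.mem_sdiff.2 ⟨hx, fun h' => h (Finset.mem_filter.1 h').2⟩)
    have haK : a ∈ K := Finset.mem_filter.2 ⟨ha.1, Or.inl rfl⟩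
    have hsub : s \ K ⊆ s.erase a := fun x hx => by
      obtain ⟨h1, h2⟩ := Finset.mem_sdiff.1 hx
      exact Finset.mem_erase.2 ⟨fun h => h2 (h ▸ haK), h1⟩
    obtain ⟨t₁, ht₁, hanti₁, f₁, hlt₁, hchain₁⟩ :=
      ih (s \ K) (Finset.ssubset_iff_subset_ne.2 ⟨Finset.sdiff_subset, fun h => by
        have := h ▸ ha.1
        exact (Finset.mem_sdiff.1 this).2 haK⟩)
    have hcard : t₁.card < t₀.card := by
      by_contra hge
      obtain ⟨x, hx, hxc⟩ := hit t₁ (ht₁.trans hsub) hanti₁ (not_lt.1 hge) c hc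
      have hxle := hmax t₁ (ht₁.trans hsub) hanti₁ (not_lt.1 hge) x hx hxc
      obtain ⟨h1, h2⟩ := Finset.mem_sdiff.1 (ht₁ hx)
      exact h2 (Finset.mem_filter.2 ⟨h1, Or.inr ⟨hxc, hxle⟩⟩)
    refine ⟨t₀, ht₀.trans (Finset.erase_subset _ _), hanti₀,
      fun x => if x ∈ s \ K then f₁ x else t₁.card, fun x _ => ?_, fun x hx y hy hxy => ?_⟩
    · dsimp only
      split_ifs with h
      · exact (hlt₁ x h).trans hcard
      · exact hcard
    · dsimp only at hxy
      split_ifs at hxy with h1 h2 h2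
      · exact hchain₁ x h1 y h2 hxy
      · exact absurd hxy (hlt₁ x h1).ne
      · exact absurd hxy (hlt₁ y h2).ne'
      · rcases hK x hx h1 with rfl | ⟨h3, h4⟩ <;> rcases hK y hy h2 with rfl | ⟨h5, h6⟩
        · exact Or.inl le_rfl
        · exact Or.inr (h6.trans hca)
        · exact Or.inl (h4.trans hca)
        · by_cases hxa : x = a
          · exact Or.inr (hxa ▸ h6.trans hca)
          by_cases hya : y = a
          · exact Or.inl (hya ▸ h4.trans hca)
          exact hchain₀ x (Finset.mem_erase.2 ⟨hxa, hx⟩) y (Finset.mem_erase.2 ⟨hya, hy⟩)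
            (h3.trans h5.symm)
  · -- the elements `top c` together with `a` form an antichain
    push Not at hcase
    have hnot : ∀ c < t₀.card, ¬ a ≤ top c := fun c hc h =>
      hcase c hc (ha.2 (Finset.mem_of_mem_erase (htop c hc).1) h)
    have hinj : ∀ c < t₀.card, ∀ d < t₀.card, top c = top d → c = d := fun c hc d hd h => by
      rw [← (htop c hc).2.1, h, (htop d hd).2.1]
    have hanti : ∀ c < t₀.card, ∀ d < t₀.card, c ≠ d → ¬ top c ≤ top d := by
      intro c hc d hd hne hle
      obtain ⟨-, hdc, ⟨t, ht, hanti, hcard, hmem⟩, -⟩ := htop d hd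
      obtain ⟨y, hy, hyc⟩ := hit t ht hanti hcard c hc
      have hyle := (htop c hc).2.2.2 t ht hanti hcard y hy hyc
      refine hanti hy hmem (fun h => hne ?_) (hyle.trans hle)
      rw [← hyc, ← hdc, h]
    have hanot : a ∉ (Finset.range t₀.card).image top := by
      intro h
      obtain ⟨c, hc, hca⟩ := Finset.mem_image.1 h
      exact hcase c (Finset.mem_range.1 hc) hca.le
    have hcard : (insert a ((Finset.range t₀.card).image top)).card = t₀.card + 1 := by
      rw [Finset.card_insert_of_notMem hanot, Finset.card_image_of_injOn, Finset.card_range]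
      intro c hc d hd h
      exact hinj c (by simpa using hc) d (by simpa using hd) h
    refine ⟨insert a ((Finset.range t₀.card).image top), ?_, ?_,
      fun x => if x = a then t₀.card else f₀ x, fun x hx => ?_, fun x hx y hy hxy => ?_⟩
    · intro x hx
      rcases Finset.mem_insert.1 hx with rfl | hx
      · exact ha.1
      · obtain ⟨c, hc, rfl⟩ := Finset.mem_image.1 hx
        exact Finset.mem_of_mem_erase (htop c (Finset.mem_range.1 hc)).1
    · intro x hx y hy hne
      simp only [Finset.coe_insert, Finset.coe_image, Finset.coe_range, Set.mem_insert_iff,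
        Set.mem_image, Set.mem_Iio] at hx hy
      rcases hx with rfl | ⟨c, hc, rfl⟩ <;> rcases hy with rfl | ⟨d, hd, rfl⟩
      · exact absurd rfl hne
      · exact hnot d hd
      · exact hcase c hc
      · exact hanti c hc d hd fun h => hne (h ▸ rfl)
    · rw [hcard]
      dsimp only
      split_ifs with h
      · omega
      · have := hlt₀ x (Finset.mem_erase.2 ⟨h, hx⟩)
        omega
    · dsimp only at hxy
      have := fun z hz h => (hlt₀ z (Finset.mem_erase.2 ⟨h, hz⟩)).ne
      split_ifs at hxy with h1 h2 h2
      · exact Or.inl (h1.trans h2.symm).le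
      · exact absurd hxy.symm (this y hy h2)
      · exact absurd hxy (this x hx h1)
      · exact hchain₀ x (Finset.mem_erase.2 ⟨h1, hx⟩) y (Finset.mem_erase.2 ⟨h2, hy⟩) hxy

namespace LinExt

variable {P : Type*} [PartialOrder P]

/-- A chain can be placed above everything incomparable to it: sort the elements `z` by the part
of the chain below `z`. -/
theorem exists_chain_above (C : Set P) (hC : ∀ x ∈ C, ∀ y ∈ C, x ≤ y ∨ y ≤ x) :
    ∃ L : LinExt P, ∀ x ∈ C, ∀ y, ¬ x ≤ y → ¬ y ≤ x → L.le y x := by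
  obtain ⟨L, hL⟩ := exists_of_monotone (fun z : P => {c | c ∈ C ∧ c ≤ z})
    fun a b hab c hc => ⟨hc.1, hc.2.trans hab⟩
  refine ⟨L, fun x hx y hxy hyx => hL y x ⟨fun c hc => ⟨hc.1, ?_⟩, fun h => ?_⟩⟩
  · rcases hC c hc.1 x hx with h | h
    · exact h
    · exact absurd (h.trans hc.2) hxy
  · exact hxy (h ⟨hx, _root_.le_refl x⟩).2

/-- Fixing `a` in an antichain `A`, the other elements of `A` can be distributed below and above
`a` at will. -/
theorem two_pow_le_card_of_isAntichain [Finite P] (A : Finset P)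
    (hA : IsAntichain (· ≤ ·) (A : Set P)) : 2 ^ (A.card - 1) ≤ Nat.card (LinExt P) := by
  classical
  rcases A.eq_empty_or_nonempty with rfl | ⟨a, ha⟩
  · exact Nat.card_pos (α := LinExt P)
  have key : ∀ B : Finset P, B ⊆ A.erase a → ∃ L : LinExt P, ∀ x ∈ A.erase a,
      L.le x a ↔ x ∈ B := by
    intro B hB
    -- the levels: `0` on `B`, `1` at `a`, `2` on the rest of `A`
    obtain ⟨L, hL⟩ := exists_of_monotone (fun z : P =>
      (if ∃ c ∈ A \ B, c ≤ z then 1 else 0) + (if ∃ c ∈ A.erase a \ B, c ≤ z then 1 else 0))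
      (by
        have hmono : ∀ D : Finset P, Monotone fun z : P => if ∃ c ∈ D, c ≤ z then 1 else 0 := by
          intro D x y hxy
          dsimp only
          split_ifs with h1 h2
          · exact _root_.le_refl _
          · exact absurd (h1.imp fun c hc => ⟨hc.1, hc.2.trans hxy⟩) h2
          · exact Nat.zero_le _
          · exact _root_.le_refl _
        exact (hmono _).add (hmono _))
    have hex : ∀ D ⊆ A, ∀ z ∈ A, (∃ c ∈ D, c ≤ z) ↔ z ∈ D := by
      refine fun D hD z hz => ⟨fun ⟨c, hc, hcz⟩ => ?_, fun h => ⟨z, h, _root_.le_refl z⟩⟩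
      rwa [← hA.eq (hD hc) hz hcz]
    have haB : a ∉ B := fun h => by simpa using hB h
    refine ⟨L, fun x hx => ?_⟩
    have hxA := Finset.mem_of_mem_erase hx
    have hxa := Finset.ne_of_mem_erase hx
    have h1 := hL x a
    have h2 := hL a x
    simp only [hex _ Finset.sdiff_subset x hxA, hex _ Finset.sdiff_subset a ha,
      hex _ (Finset.sdiff_subset.trans (Finset.erase_subset _ _)) x hxA,
      hex _ (Finset.sdiff_subset.trans (Finset.erase_subset _ _)) a ha] at h1 h2
    by_cases hxB : x ∈ B
    · simpa [hxB, haB, hxA, hxa, ha] using h1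
    · simp only [hxB, iff_false]
      intro h
      exact hxa (L.le_antisymm _ _ h (by simpa [hxB, haB, hxA, hxa, ha] using h2))
  choose! L hL using key
  have hinj : Set.InjOn L ((A.erase a).powerset : Set (Finset P)) := by
    intro B hB D hD h
    have hB := Finset.mem_powerset.1 hB
    have hD := Finset.mem_powerset.1 hD
    ext x
    by_cases hx : x ∈ A.erase a
    · rw [← hL B hB x hx, ← hL D hD x hx, h]
    · exact iff_of_false (fun h' => hx (hB h')) (fun h' => hx (hD h'))
  have hcard := Set.ncard_le_ncard (Set.subset_univ (L '' ((A.erase a).powerset : Set (Finset P))))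
  rwa [hinj.ncard_image, Set.ncard_coe_finset, Finset.card_powerset,
    Finset.card_erase_of_mem ha, Set.ncard_univ] at hcard

theorem two_pow_posetDim_le_card [Finite P] : 2 ^ (posetDim P - 1) ≤ Nat.card (LinExt P) := by
  classical
  have := Fintype.ofFinite P
  obtain ⟨t, -, hanti, f, hlt, hchain⟩ :=
    exists_isAntichain_chain_partition (Finset.univ : Finset P)
  refine _root_.le_trans (Nat.pow_le_pow_right two_pos ?_) (two_pow_le_card_of_isAntichain t hanti)
  rcases isEmpty_or_nonempty P with hP | ⟨⟨x₀⟩⟩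
  · have : posetDim P ≤ 1 := Nat.sInf_le ⟨{Classical.arbitrary (LinExt P)},
      ⟨by simp, fun x => (hP.false x).elim⟩, by simp⟩
    omega
  · choose L hL using fun c => exists_chain_above {x : P | f x = c}
      fun x hx y hy => hchain x (Finset.mem_univ x) y (Finset.mem_univ y) (hx.trans hy.symm)
    have hreal : IsRealizer (((Finset.range t.card).image L : Finset (LinExt P)) :
        Set (LinExt P)) := by
      have hmem : ∀ x, L (f x) ∈ (Finset.range t.card).image L := fun x =>
        Finset.mem_image_of_mem L (Finset.mem_range.2 (hlt x (Finset.mem_univ x)))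
      refine ⟨⟨_, hmem x₀⟩, fun x y => ⟨fun h M _ => M.extends_le _ _ h, fun h => ?_⟩⟩
      by_contra hxy
      have hle := h _ (hmem x)
      have hge : (L (f x)).le y x := by
        by_cases hyx : y ≤ x
        · exact (L (f x)).extends_le _ _ hyx
        · exact hL (f x) x rfl y hxy hyx
      exact hxy ((L (f x)).le_antisymm _ _ hle hge).le
    have : posetDim P ≤ _ := Nat.sInf_le ⟨_, hreal, rfl⟩
    have := Finset.card_image_le (s := Finset.range t.card) (f := L)
    rw [Finset.card_range] at this
    omega

end LinExt

/-! ### A structured language compiled to random access machines -/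

namespace RAM

variable {V : Type*} [DecidableEq V]

/-- The state of a structured program: the values of its variables, and the memory. -/
structure Store (V : Type*) where
  var : V → ℕ
  mem : ℕ → ℕ

/-- The store with the value of `x` replaced by `a`. -/
def Store.set (s : Store V) (x : V) (a : ℕ) : Store V :=
  ⟨Function.update s.var x a, s.mem⟩

theorem Store.var_set (s : Store V) (x y : V) (a : ℕ) :
    (s.set x a).var y = if y = x then a else s.var y :=
  Function.update_apply ..

theorem Store.mem_set (s : Store V) (x : V) (a : ℕ) : (s.set x a).mem = s.mem := rfl

/-- The elementary operations: the machine instructions other than jumps, on variables. -/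
inductive Op (V : Type*) where
  | const (x : V) (k : ℕ)
  | move (x y : V)
  | add (x y z : V)
  | sub (x y z : V)
  | load (x y : V)
  | store (x y : V)

/-- The effect of an operation. -/
def Op.run (s : Store V) : Op V → Store V
  | const x k => s.set x k
  | move x y => s.set x (s.var y)
  | add x y z => s.set x (s.var y + s.var z)
  | sub x y z => s.set x (s.var y - s.var z)
  | load x y => s.set x (s.mem (s.var y))
  | store x y => ⟨s.var, Function.update s.mem (s.var x) (s.var y)⟩

/-- The variable an operation assigns to, if any. -/
def Op.writes : Op V → List V
  | const x _ | move x _ | add x _ _ | sub x _ _ | load x _ => [x]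
  | store _ _ => []

/-- The instruction for an operation, when variable `x` lives in register `e x`. -/
def Op.toInstr (e : V → ℕ) : Op V → Instr
  | const x k => .const (e x) k
  | move x y => .move (e x) (e y)
  | add x y z => .add (e x) (e y) (e z)
  | sub x y z => .sub (e x) (e y) (e z)
  | load x y => .load (e x) (e y)
  | store x y => .store (e x) (e y)

/-- Structured programs: straight-line code, composition, execution of `c` if `x ≠ 0`, and
repetition of `c` while `x ≠ 0`. -/
inductive Cmd (V : Type*) where
  | ops (l : List (Op V))
  | seq (c d : Cmd V)
  | ifNonzero (x : V) (c : Cmd V)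
  | loop (x : V) (c : Cmd V)

namespace Cmd

/-- The variables a program may assign to. -/
def writes : Cmd V → List V
  | ops l => l.flatMap Op.writes
  | seq c d => c.writes ++ d.writes
  | ifNonzero _ c => c.writes
  | loop _ c => c.writes

/-- The length of the compiled program. -/
def size : Cmd V → ℕ
  | ops l => l.length
  | seq c d => c.size + d.size
  | ifNonzero _ c => c.size + 1
  | loop _ c => c.size + 2

/-- The machine code, to be placed from line `off` on. -/
def compile (e : V → ℕ) : ℕ → Cmd V → List Instr
  | _, ops l => l.map (Op.toInstr e)
  | off, seq c d => c.compile e off ++ d.compile e (off + c.size)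
  | off, ifNonzero x c => .jumpZero (e x) (off + c.size + 1) :: c.compile e (off + 1)
  | off, loop x c =>
      .jumpZero (e x) (off + c.size + 2) :: (c.compile e (off + 1) ++ [.jump off])

theorem length_compile {U : Type*} (e : U → ℕ) (c : Cmd U) (off : ℕ) : (c.compile e off).length = c.size := by
  induction c generalizing off with
  | ops l => simp [compile, size]
  | seq c d hc hd => simp [compile, size, hc, hd]
  | ifNonzero x c hc => simp [compile, size, hc]
  | loop x c hc => simp [compile, size, hc]

/-- `Runs c s s' t`: started in `s`, the program `c` ends in `s'`, and its compiled version takes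
`t` steps. -/
inductive Runs : Cmd V → Store V → Store V → ℕ → Prop
  | ops (l s) : Runs (ops l) s (l.foldl Op.run s) l.length
  | seq {c d s₁ s₂ s₃ t₁ t₂} : Runs c s₁ s₂ t₁ → Runs d s₂ s₃ t₂ → Runs (seq c d) s₁ s₃ (t₁ + t₂)
  | ifZero {x c s} : s.var x = 0 → Runs (ifNonzero x c) s s 1
  | ifNonzero {x c s s' t} : s.var x ≠ 0 → Runs c s s' t → Runs (ifNonzero x c) s s' (1 + t)
  | loopZero {x c s} : s.var x = 0 → Runs (loop x c) s s 1
  | loopNonzero {x c s₁ s₂ s₃ t₁ t₂} : s₁.var x ≠ 0 → Runs c s₁ s₂ t₁ →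
      Runs (loop x c) s₂ s₃ t₂ → Runs (loop x c) s₁ s₃ (1 + t₁ + 1 + t₂)

theorem Runs.var_eq {c : Cmd V} {s s' : Store V} {t : ℕ} (h : Runs c s s' t) :
    ∀ v ∉ c.writes, s'.var v = s.var v := by
  induction h with
  | ops l s =>
    intro v hv
    induction l generalizing s with
    | nil => rfl
    | cons o l ih =>
      simp only [writes, List.flatMap_cons, List.mem_append, not_or] at hv ih
      rw [List.foldl_cons, ih _ hv.2]
      cases o <;> simp_all [Op.run, Op.writes, Store.var_set]
  | seq _ _ h1 h2 =>
    intro v hv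
    simp only [writes, List.mem_append, not_or] at hv
    rw [h2 v hv.2, h1 v hv.1]
  | ifZero => exact fun _ _ => rfl
  | ifNonzero _ _ h => exact h
  | loopZero => exact fun _ _ => rfl
  | loopNonzero _ _ _ h1 h2 =>
    intro v hv
    rw [h2 v hv, h1 v hv]

end Cmd

/-- The machine configuration `cfg` represents the store `s`, with control at line `pc`. -/
structure Represents (e : V → ℕ) (cfg : Config) (pc : ℕ) (s : Store V) : Prop where
  pc_eq : cfg.pc = pc
  reg_eq : ∀ v, cfg.reg (e v) = s.var v
  mem_eq : cfg.mem = s.mem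

/-- The program `p` contains the code `l` from line `off` on. -/
def CodeAt (p : Program) (off : ℕ) (l : List Instr) : Prop :=
  ∃ pre post, p = pre ++ l ++ post ∧ pre.length = off

theorem CodeAt.left {p : Program} {off : ℕ} {l l' : List Instr} (h : CodeAt p off (l ++ l')) :
    CodeAt p off l := by
  obtain ⟨pre, post, rfl, rfl⟩ := h
  exact ⟨pre, l' ++ post, by simp, rfl⟩

theorem CodeAt.right {p : Program} {off : ℕ} {l l' : List Instr} (h : CodeAt p off (l ++ l')) :
    CodeAt p (off + l.length) l' := by
  obtain ⟨pre, post, rfl, rfl⟩ := h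
  exact ⟨pre ++ l, post, by simp, by simp⟩

theorem CodeAt.tail {p : Program} {off : ℕ} {i : Instr} {l : List Instr}
    (h : CodeAt p off (i :: l)) : CodeAt p (off + 1) l :=
  CodeAt.right (l := [i]) h

theorem CodeAt.step_eq {p : Program} {off : ℕ} {i : Instr} {l : List Instr} {cfg : Config}
    (h : CodeAt p off (i :: l)) (hcfg : cfg.pc = off) : step p cfg = i.exec cfg := by
  obtain ⟨pre, post, rfl, rfl⟩ := h
  simp [step, hcfg]

theorem Represents.step_op {e : V → ℕ} (he : Function.Injective e) {p : Program} {off : ℕ}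
    {o : Op V} {l : List Instr} {cfg : Config} {s : Store V} (hp : CodeAt p off (o.toInstr e :: l))
    (h : Represents e cfg off s) : Represents e (step p cfg) (off + 1) (o.run s) := by
  rw [hp.step_eq h.pc_eq]
  obtain ⟨h1, h2, h3⟩ := h
  cases o <;>
    exact ⟨by simp [Op.toInstr, Instr.exec, h1],
      fun v => by simp [Op.toInstr, Instr.exec, Op.run, Store.set, Function.update_apply,
        he.eq_iff, h2, h3],
      by simp [Op.toInstr, Instr.exec, Op.run, Store.set, h2, h3]⟩

/-- Correctness of the compiler. -/
theorem Cmd.Runs.represents {e : V → ℕ} (he : Function.Injective e) {p : Program} {c : Cmd V}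
    {s s' : Store V} {t : ℕ} (h : Runs c s s' t) :
    ∀ off cfg, CodeAt p off (c.compile e off) → Represents e cfg off s →
      Represents e ((step p)^[t] cfg) (off + c.size) s' := by
  induction h with
  | ops l s =>
    induction l generalizing s with
    | nil => exact fun off cfg _ h => h
    | cons o l ih =>
      intro off cfg hp h
      have := ih (o.run s) (off + 1) _ hp.tail (h.step_op he hp)
      rw [List.length_cons, Function.iterate_succ_apply, List.foldl_cons]
      convert this using 1
      simp only [size, List.length_cons]
      omega
  | @seq c d s₁ s₂ s₃ t₁ t₂ _ _ h1 h2 =>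
    intro off cfg hp h
    rw [add_comm, Function.iterate_add_apply, size, ← add_assoc]
    refine h2 _ _ ?_ (h1 _ _ hp.left h)
    simpa [length_compile] using hp.right
  | @ifZero x c s hx =>
    intro off cfg hp h
    rw [Function.iterate_one, hp.step_eq h.pc_eq]
    exact ⟨by simp [Instr.exec, h.reg_eq, hx, size, add_assoc], h.reg_eq, h.mem_eq⟩
  | @ifNonzero x c s s' t hx _ ih =>
    intro off cfg hp h
    rw [add_comm, Function.iterate_succ_apply, hp.step_eq h.pc_eq]
    have := ih (off + 1) (Instr.exec cfg (.jumpZero (e x) (off + c.size + 1))) hp.tail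
      ⟨by simp [Instr.exec, h.reg_eq, hx, h.pc_eq], h.reg_eq, h.mem_eq⟩
    convert this using 1
    simp only [size]
    omega
  | @loopZero x c s hx =>
    intro off cfg hp h
    rw [Function.iterate_one, hp.step_eq h.pc_eq]
    exact ⟨by simp [Instr.exec, h.reg_eq, hx, size, add_assoc], h.reg_eq, h.mem_eq⟩
  | @loopNonzero x c s₁ s₂ s₃ t₁ t₂ hx _ _ h1 h2 =>
    intro off cfg hp h
    rw [show 1 + t₁ + 1 + t₂ = t₂ + (1 + (t₁ + 1)) by omega, Function.iterate_add_apply,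
      Function.iterate_add_apply, Function.iterate_one, Function.iterate_succ_apply, hp.step_eq h.pc_eq]
    refine h2 _ _ hp ?_
    have := h1 (off + 1) (Instr.exec cfg (.jumpZero (e x) (off + c.size + 2))) hp.tail.left
      ⟨by simp [Instr.exec, h.reg_eq, hx, h.pc_eq], h.reg_eq, h.mem_eq⟩
    have hj := hp.tail.right
    rw [length_compile] at hj
    rw [hj.step_eq this.pc_eq]
    exact ⟨rfl, this.reg_eq, this.mem_eq⟩

namespace Cmd

/-- Total correctness with a time bound: started in `s`, the program `c` ends after at most `T`
steps in a store satisfying `Q`. -/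
def Ends (c : Cmd V) (s : Store V) (Q : Store V → Prop) (T : ℕ) : Prop :=
  ∃ s' t, Runs c s s' t ∧ t ≤ T ∧ Q s'

theorem Ends.mono {c : Cmd V} {s : Store V} {Q Q' : Store V → Prop} {T T' : ℕ}
    (h : Ends c s Q T) (hQ : ∀ s', Q s' → Q' s') (hT : T ≤ T') : Ends c s Q' T' := by
  obtain ⟨s', t, h1, h2, h3⟩ := h
  exact ⟨s', t, h1, h2.trans hT, hQ _ h3⟩

/-- A program changes only the variables it assigns to. -/
theorem Ends.frame {c : Cmd V} {s : Store V} {Q : Store V → Prop} {T : ℕ} (h : Ends c s Q T) :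
    Ends c s (fun s' => Q s' ∧ ∀ v ∉ c.writes, s'.var v = s.var v) T := by
  obtain ⟨s', t, h1, h2, h3⟩ := h
  exact ⟨s', t, h1, h2, h3, h1.var_eq⟩

theorem Ends.ops {l : List (Op V)} {s : Store V} {Q : Store V → Prop}
    (h : Q (l.foldl Op.run s)) : Ends (ops l) s Q l.length :=
  ⟨_, _, .ops l s, le_rfl, h⟩

theorem Ends.seq {c d : Cmd V} {s : Store V} {R Q : Store V → Prop} {T₁ T₂ : ℕ}
    (hc : Ends c s R T₁) (hd : ∀ s', R s' → Ends d s' Q T₂) : Ends (seq c d) s Q (T₁ + T₂) := by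
  obtain ⟨s', t, h1, h2, h3⟩ := hc
  obtain ⟨s'', t', h4, h5, h6⟩ := hd s' h3
  exact ⟨s'', t + t', h1.seq h4, by omega, h6⟩

theorem Ends.ifNonzero {x : V} {c : Cmd V} {s : Store V} {Q : Store V → Prop} {T : ℕ}
    (h0 : s.var x = 0 → Q s) (h1 : s.var x ≠ 0 → Ends c s Q T) :
    Ends (ifNonzero x c) s Q (1 + T) := by
  by_cases hx : s.var x = 0
  · exact ⟨s, 1, .ifZero hx, by omega, h0 hx⟩
  · obtain ⟨s', t, h2, h3, h4⟩ := h1 hx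
    exact ⟨s', 1 + t, .ifNonzero hx h2, by omega, h4⟩

/-- The rule for loops: `I k` holds when exactly `k` iterations are left. -/
theorem Ends.loop {x : V} {c : Cmd V} {T : ℕ} (I : ℕ → Store V → Prop)
    (h0 : ∀ s, I 0 s → s.var x = 0)
    (hstep : ∀ k s, I (k + 1) s → s.var x ≠ 0 ∧ Ends c s (I k) T) (k : ℕ) (s : Store V)
    (h : I k s) : Ends (loop x c) s (I 0) (k * (T + 2) + 1) := by
  induction k generalizing s with
  | zero => exact ⟨s, 1, .loopZero (h0 s h), by omega, h⟩
  | succ k ih =>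
    obtain ⟨hx, s', t, h1, h2, h3⟩ := hstep k s h
    obtain ⟨s'', t', h4, h5, h6⟩ := ih s' h3
    refine ⟨s'', _, .loopNonzero hx h1 h4, ?_, h6⟩
    rw [add_mul]
    omega

end Cmd

end RAM

/-! ### The program -/

namespace RAM

/-- The variables of the program: the input size `n`, the constants `one` and `sq` (`n * n`), the
loop indices `r`, `i`, `j`, `k`, the number `t` of the list under test with the number `bad` of edges
it misses, the results `len` and `flag` of scanning it, and auxiliary variables. -/
inductive Var where
  | n | one | sq | r | i | j | k | rem | adr | cnt | acc | tmp | t | bad | q | len | flag | vtx | gap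
  deriving DecidableEq

open Cmd

namespace HullProgram

/-- For `x` from `0` to `n - 1`, run `body`. All loops share the variable `rem`, which is recomputed
before every test. -/
def forLoop (x : Var) (body : Cmd Var) : Cmd Var :=
  .seq (.ops [.const x 0, .sub .rem .n x])
    (.loop .rem (.seq body (.ops [.add x x .one, .sub .rem .n x])))

/-- `adr := x * n + y`, the address of an entry of the adjacency matrix. -/
def address (x y : Var) : Cmd Var :=
  .seq (.ops [.move .adr y, .move .cnt x])
    (.loop .cnt (.ops [.add .adr .adr .n, .sub .cnt .cnt .one]))

/-- `adr := x * n + y + n * n`, the address of an entry of the second matrix. -/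
def cell (x y : Var) : Cmd Var :=
  .seq (address x y) (.ops [.add .adr .adr .sq])

/-- Set `one := 1` and `sq := n * n`, and put `n` on the diagonal of the second matrix, stored behind
the adjacency matrix. The other entries are `0`, like all of the unused memory. -/
def setup : Cmd Var :=
  .seq (.ops [.const .one 1, .const .acc 0]) <|
  .seq (address .n .acc) <|
  .seq (.ops [.move .sq .adr]) <|
  forLoop .i (.seq (cell .i .i) (.ops [.store .adr .n]))

/-- If `j` and `k` are adjacent, replace the entry `(i, k)` of the second matrix by its maximum
with the entry `(i, j)` minus one. With truncated subtraction, `y + (x - y)` is the maximum. -/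
def relax : Cmd Var :=
  .seq (address .j .k) <|
  .seq (.ops [.load .acc .adr]) <|
  .ifNonzero .acc <|
  .seq (cell .i .j) <|
  .seq (.ops [.load .acc .adr, .sub .acc .acc .one]) <|
  .seq (cell .i .k) <|
  .ops [.load .tmp .adr, .sub .acc .acc .tmp, .add .tmp .tmp .acc, .store .adr .tmp]

/-- `n` rounds of relaxation: the entry `(i, j)` becomes `n` minus the distance of `i` and `j`.
Storing `n` minus the distance lets the initial value `0` stand for unknown distances. -/
def distances : Cmd Var :=
  forLoop .r (forLoop .i (forLoop .j (forLoop .k relax)))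

/-- Run through the list encoded by `t`. Compute its length `len`, and the sum `flag` of the
truncated differences of the entries `(v, i)` and `(v, j)` of the second matrix, where `v` ranges
over the list. -/
def scan : Cmd Var :=
  .seq (.ops [.move .q .t, .const .len 0, .const .flag 0]) <|
  .loop .q <|
  .seq (.ops [.sub .vtx .q .one, .const .q 0, .add .gap .vtx .one, .sub .gap .gap .n]) <|
  .seq (.loop .gap (.ops [.sub .vtx .vtx .n, .add .q .q .one, .add .gap .vtx .one, .sub .gap .gap .n])) <|
  .seq (cell .vtx .i) <|
  .seq (.ops [.load .acc .adr]) <|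
  .seq (cell .vtx .j) <|
  .ops [.load .tmp .adr, .sub .acc .acc .tmp, .add .flag .flag .acc, .add .len .len .one]

/-- Increase `bad` if `(i, j)` is an edge not covered by the list encoded by `t`. As `flag` is a
natural number, `1 - flag` is `1` if `flag` is zero, and `0` otherwise. -/
def checkEdge : Cmd Var :=
  .seq scan <|
  .seq (address .i .j) <|
  .seq (.ops [.load .acc .adr]) <|
  .ifNonzero .acc (.ops [.sub .tmp .one .flag, .add .bad .bad .tmp])

/-- Find the first `t ≥ 1` whose list covers all edges. -/
def search : Cmd Var :=
  .seq (.ops [.const .t 0, .const .bad 1]) <|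
  .loop .bad <|
  .seq (.ops [.add .t .t .one, .const .bad 0]) <|
  forLoop .i (forLoop .j checkEdge)

/-- Compute the distances, find the first list covering all edges, and return its length, which the
last `scan` determines. -/
def program : Cmd Var :=
  .seq setup <| .seq distances <| .seq search <| .seq scan <| .ops [.move .n .len]

/-! ### Correctness and running time of the parts -/

/-- The rule for `forLoop`: the invariant `I k` holds before the iteration with `x = k`, and must not
depend on the loop variables. -/
theorem ends_forLoop {x : Var} {body : Cmd Var} {N T : ℕ} {s : Store Var}
    (I : ℕ → Store Var → Prop) (hN : s.var .n = N) (h1 : s.var .one = 1)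
    (hx : x ≠ .n ∧ x ≠ .one ∧ x ≠ .rem)
    (hb : .n ∉ body.writes ∧ .one ∉ body.writes ∧ x ∉ body.writes)
    (hI : ∀ k s u w, I k s → I k ((s.set x u).set .rem w)) (h0 : I 0 s)
    (hstep : ∀ k < N, ∀ s', s'.var x = k →
      (∀ v, v ≠ x → v ≠ .rem → v ∉ body.writes → s'.var v = s.var v) → I k s' →
      Ends body s' (I (k + 1)) T) :
    Ends (forLoop x body) s (I N) (N * (T + 4) + 3) := by
  obtain ⟨hxn, hx1, hxr⟩ := hx
  obtain ⟨hbn, hb1, hbx⟩ := hb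
  -- `J m` describes the store when `m` iterations are left
  let J : ℕ → Store Var → Prop := fun m s' => m ≤ N ∧ s'.var x = N - m ∧ s'.var .rem = m ∧
    (∀ v, v ≠ x → v ≠ .rem → v ∉ body.writes → s'.var v = s.var v) ∧ I (N - m) s'
  have hJ : Ends (forLoop x body) s (J 0) (2 + (N * (T + 2 + 2) + 1)) := by
    refine (Ends.ops (Q := J N) ?_).seq fun s' => Ends.loop J ?_ ?_ N s'
    · refine ⟨le_rfl, ?_, ?_, ?_, ?_⟩
      · simp [Op.run, Store.var_set, hxr]
      · simp [Op.run, Store.var_set, hxn.symm, hN]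
      · intro v hv hv' _
        simp [Op.run, Store.var_set, hv, hv']
      · rw [Nat.sub_self]
        exact hI _ _ _ _ h0
    · exact fun s' h => h.2.2.1
    · rintro m s' ⟨hm, hxs, hrs, hfr, hIs⟩
      refine ⟨by omega, ((hstep _ (by omega) s' hxs hfr hIs).frame.seq fun s'' h => ?_)⟩
      obtain ⟨hI', hfr'⟩ := h
      have hx' : s''.var x = N - (m + 1) := (hfr' _ hbx).trans hxs
      have hn' : s''.var .n = N := by
        rw [hfr' _ hbn, hfr _ hxn.symm (by decide) hbn, hN]
      have h1' : s''.var .one = 1 := by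
        rw [hfr' _ hb1, hfr _ hx1.symm (by decide) hb1, h1]
      refine Ends.ops ⟨by omega, ?_, ?_, ?_, ?_⟩
      · simp [Op.run, Store.var_set, hxr, hx', h1']
        omega
      · simp [Op.run, Store.var_set, hxn.symm, hx', h1', hn']
        omega
      · intro v hv hv' hvb
        simp [Op.run, Store.var_set, hv, hv', hfr' _ hvb, hfr _ hv hv' hvb]
      · rw [show N - m = N - (m + 1) + 1 by omega]
        exact hI _ _ _ _ hI'
  refine hJ.mono (fun s' h => h.2.2.2.2) (by rw [add_assoc T]; omega)

theorem ends_address {x y : Var} {s : Store Var} (h1 : s.var .one = 1)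
    (hx : x ≠ .adr) :
    Ends (address x y) s (fun s' => s'.mem = s.mem ∧ s'.var .adr = s.var x * s.var .n + s.var y ∧
      ∀ v, v ≠ .adr → v ≠ .cnt → s'.var v = s.var v) (4 * s.var x + 3) := by
  let I : ℕ → Store Var → Prop := fun m s' => s'.mem = s.mem ∧ s'.var .cnt = m ∧
    s'.var .adr + m * s.var .n = s.var x * s.var .n + s.var y ∧
    ∀ v, v ≠ .adr → v ≠ .cnt → s'.var v = s.var v
  have hI : Ends (address x y) s (I 0) (2 + (s.var x * (2 + 2) + 1)) := by
    refine (Ends.ops (Q := I (s.var x)) ?_).seq fun s' => Ends.loop I ?_ ?_ _ s'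
    · refine ⟨rfl, ?_, ?_, ?_⟩
      · simp [Op.run, Store.var_set, hx]
      · simp [Op.run, Store.var_set, add_comm]
      · intro v hv hv'
        simp [Op.run, Store.var_set, hv, hv']
    · exact fun s' h => h.2.1
    · rintro m s' ⟨hm, hc, ha, hfr⟩
      refine ⟨by omega, Ends.ops ⟨hm, ?_, ?_, ?_⟩⟩
      · simp [Op.run, Store.var_set, hc, hfr .one, h1]
      · simp [Op.run, Store.var_set, hfr .n]
        rw [← ha]
        ring
      · intro v hv hv'
        simp [Op.run, Store.var_set, hv, hv', hfr v hv hv']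
  exact hI.mono (fun s' h => ⟨h.1, by simpa using h.2.2.1, h.2.2.2⟩) (by omega)

theorem ends_cell {x y : Var} {s : Store Var} (h1 : s.var .one = 1) (hx : x ≠ .adr) :
    Ends (cell x y) s (fun s' => s'.mem = s.mem ∧
      s'.var .adr = s.var x * s.var .n + s.var y + s.var .sq ∧
      ∀ v, v ≠ .adr → v ≠ .cnt → s'.var v = s.var v) (4 * s.var x + 4) := by
  refine (ends_address h1 hx).seq (T₂ := 1) fun s' ⟨hm, ha, hfr⟩ => Ends.ops ⟨hm, ?_, ?_⟩
  · simp [Op.run, Store.var_set, ha, hfr .sq]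
  · intro v hv hv'
    simp [Op.run, Store.var_set, hv, hfr v hv hv']

/-- The list of numbers below `n` encoded by `t`: its bijective base-`n` representation, so that
lists are enumerated by increasing length. -/
def decode (n : ℕ) : ℕ → List ℕ
  | 0 => []
  | t + 1 => t % n :: decode n (t / n)
decreasing_by exact Nat.lt_succ_of_le (Nat.div_le_self t n)

theorem length_decode_le (n t : ℕ) : (decode n t).length ≤ t := by
  induction t using Nat.strong_induction_on with
  | _ t ih =>
    cases t with
    | zero => simp [decode]
    | succ t =>
      have h := Nat.div_le_self t n
      have := ih (t / n) (by omega)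
      simp only [decode, List.length_cons]
      omega

/-- The number `scan` adds to `flag` for the list element `v`. -/
def gain (s : Store Var) (v : ℕ) : ℕ :=
  s.mem (v * s.var .n + s.var .i + s.var .sq) - s.mem (v * s.var .n + s.var .j + s.var .sq)

/-- Division with remainder by repeated subtraction. -/
theorem ends_division {s : Store Var} (h1 : s.var .one = 1) (hn : 0 < s.var .n)
    (hq : s.var .q = 0) (hg : s.var .gap = s.var .vtx + 1 - s.var .n) :
    Ends (.loop .gap (.ops [.sub .vtx .vtx .n, .add .q .q .one, .add .gap .vtx .one, .sub .gap .gap .n])) s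
      (fun s' => s'.mem = s.mem ∧ s'.var .vtx = s.var .vtx % s.var .n ∧
        s'.var .q = s.var .vtx / s.var .n) (s.var .vtx * 6 + 1) := by
  let I : ℕ → Store Var → Prop := fun m s' => s'.mem = s.mem ∧ s'.var .vtx / s.var .n = m ∧
    s'.var .q + m = s.var .vtx / s.var .n ∧ s'.var .vtx % s.var .n = s.var .vtx % s.var .n ∧
    s'.var .gap = s'.var .vtx + 1 - s.var .n ∧ s'.var .n = s.var .n ∧ s'.var .one = 1
  refine (Ends.loop (T := 4) I ?_ ?_ (s.var .vtx / s.var .n) s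
    ⟨rfl, rfl, by omega, rfl, hg, rfl, h1⟩).mono ?_ ?_
  · rintro s' ⟨-, hv, -, -, hg, -⟩
    have := (Nat.div_eq_zero_iff.1 hv).resolve_left hn.ne'
    omega
  · rintro m s' ⟨hm, hv, hq, hmod, hg, hn', h1'⟩
    have hle : s.var .n ≤ s'.var .vtx := by
      by_contra hlt
      rw [Nat.div_eq_of_lt (not_le.1 hlt)] at hv
      omega
    refine ⟨by omega, Ends.ops ⟨hm, ?_, ?_, ?_, ?_, ?_, ?_⟩⟩
    · have := Nat.sub_mul_div (s'.var .vtx) (s.var .n) 1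
      rw [mul_one, hv] at this
      simpa [Op.run, Store.var_set, hn'] using this
    · simp [Op.run, Store.var_set, h1']
      omega
    · simp [Op.run, Store.var_set, hn', ← hmod, Nat.mod_eq_sub_mod hle]
    · simp [Op.run, Store.var_set, hn', h1']
    · simp [Op.run, Store.var_set, hn']
    · simp [Op.run, Store.var_set, h1']
  · rintro s' ⟨hm, hv, hq, hmod, -, -⟩
    refine ⟨hm, ?_, by omega⟩
    rw [← hmod, Nat.mod_eq_of_lt ((Nat.div_eq_zero_iff.1 hv).resolve_left hn.ne')]
  · have := Nat.div_le_self (s.var .vtx) (s.var .n)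
    omega

theorem ends_scan {s : Store Var} {X : ℕ} (h1 : s.var .one = 1) (hn : 0 < s.var .n)
    (hX : s.var .n ≤ X) (hX' : s.var .t ≤ X) :
    Ends scan s (fun s' => s'.mem = s.mem ∧ s'.var .len = (decode (s.var .n) (s.var .t)).length ∧
      s'.var .flag = ((decode (s.var .n) (s.var .t)).map (gain s)).sum) (38 * X ^ 2) := by
  -- with `m` list elements left, `len` and `flag` have reached their final values up to the length
  -- of the remaining list and its total gain
  let I : ℕ → Store Var → Prop := fun m s' => s'.mem = s.mem ∧ s'.var .q ≤ s.var .t ∧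
    (decode (s.var .n) (s'.var .q)).length = m ∧
    s'.var .len + m = (decode (s.var .n) (s.var .t)).length ∧
    s'.var .flag + ((decode (s.var .n) (s'.var .q)).map (gain s)).sum =
      ((decode (s.var .n) (s.var .t)).map (gain s)).sum ∧
    ∀ v ∉ scan.writes, s'.var v = s.var v
  have hI : Ends scan s (I 0)
      (3 + ((decode (s.var .n) (s.var .t)).length * (14 * X + 18 + 2) + 1)) := by
    refine (Ends.ops (Q := I (decode (s.var .n) (s.var .t)).length) ?_).seq fun s' =>
      Ends.loop I ?_ ?_ _ s'
    · refine ⟨rfl, ?_, ?_, ?_, ?_, ?_⟩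
      · simp [Op.run, Store.var_set]
      · simp [Op.run, Store.var_set]
      · simp [Op.run, Store.var_set]
      · simp [Op.run, Store.var_set]
      · intro v hv
        simp only [scan, cell, address, writes, List.flatMap_cons, Op.writes, List.mem_append,
          List.flatMap_nil, List.mem_singleton, not_or] at hv
        simp [Op.run, Store.var_set, hv]
    · rintro s' ⟨-, -, hl, -⟩
      by_contra hq
      obtain ⟨q, hq⟩ := Nat.exists_eq_succ_of_ne_zero hq
      simp [hq, decode] at hl
    · rintro m s' ⟨hm, hqt, hl, hlen, hflag, hfr⟩
      have hq : s'.var .q ≠ 0 := by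
        intro hq
        simp [hq, decode] at hl
      obtain ⟨q, hq'⟩ := Nat.exists_eq_succ_of_ne_zero hq
      rw [hq', decode] at hl hflag
      simp only [List.length_cons, List.map_cons, List.sum_cons] at hl hflag
      refine ⟨hq, ?_⟩
      refine Ends.mono (T := 4 + (q * 6 + 1 + (4 * X + 4 + (1 + (4 * X + 4 + 4)))))
        (Q := fun s'' => s''.mem = s.mem ∧ s''.var .q = q / s.var .n ∧
          s''.var .len = s'.var .len + 1 ∧
          s''.var .flag = s'.var .flag + gain s (q % s.var .n) ∧
          ∀ v ∉ scan.writes, s''.var v = s'.var v) ?_ ?_ (by omega)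
      · have hone : s'.var .one = 1 := by rw [hfr _ (by decide), h1]
        have hn' := hfr .n (by decide)
        refine Ends.mono (Ends.frame (Q := fun s'' => s''.mem = s.mem ∧
          s''.var .q = q / s.var .n ∧ s''.var .len = s'.var .len + 1 ∧
          s''.var .flag = s'.var .flag + gain s (q % s.var .n)) ?_) ?_ le_rfl
        · refine (Ends.ops (Q := fun a => a.mem = s.mem ∧ a.var .q = 0 ∧ a.var .vtx = q ∧
            a.var .gap = q + 1 - s.var .n ∧ ∀ v, v ≠ .q → v ≠ .vtx → v ≠ .gap → a.var v = s'.var v)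
            ?_).frame.seq fun a ha => ?_
          · refine ⟨hm, ?_, ?_, ?_, ?_⟩
            · simp [Op.run, Store.var_set]
            · simp [Op.run, Store.var_set, hone, hq']
            · simp [Op.run, Store.var_set, hone, hq', hn']
            · intro v h1 h2 h3
              simp [Op.run, Store.var_set, h1, h2, h3]
          obtain ⟨⟨ham, haq, hav, hag, hafr⟩, -⟩ := ha
          have han : a.var .n = s.var .n := by rw [hafr .n (by decide) (by decide) (by decide), hn']
          refine ((ends_division (s := a)
            ((hafr .one (by decide) (by decide) (by decide)).trans hone) (by omega) haq
            (by rw [hag, hav, han])).frame.mono (fun _ h => h) (by omega)).seq fun b hb => ?_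
          obtain ⟨⟨hbm, hbv, hbq⟩, hbfr⟩ := hb
          rw [hav, han] at hbv hbq
          have hbf : ∀ v ∉ scan.writes, b.var v = s.var v := by
            intro v hv
            rw [hbfr v (by cases v <;> first | decide | exact absurd (by decide) hv),
              hafr v (fun h => hv (by subst h; decide)) (fun h => hv (by subst h; decide))
                (fun h => hv (by subst h; decide)), hfr v hv]
          have hbs : ∀ v, v ≠ .q → v ≠ .vtx → v ≠ .gap → b.var v = s'.var v := by
            intro v h1 h2 h3
            rw [hbfr v (by cases v <;> simp_all [writes, Op.writes]), hafr v h1 h2 h3]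
          have hbX : b.var .vtx ≤ X := by
            rw [hbv]
            exact (Nat.mod_lt _ hn).le.trans hX
          refine ((ends_cell (s := b) ((hbf _ (by decide)).trans h1) (by decide)).mono
            (fun _ h => h) (by omega)).seq fun c ⟨hcm, hca, hcf⟩ => ?_
          refine (Ends.ops (Q := fun d => d.mem = c.mem ∧ d.var .acc = c.mem (c.var .adr) ∧
            ∀ v, v ≠ .acc → d.var v = c.var v) ?_).seq fun d ⟨hdm, hdx, hdf⟩ => ?_
          · exact ⟨rfl, by simp [Op.run, Store.var_set], fun v hv => by
              simp [Op.run, Store.var_set, hv]⟩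
          have hdb : ∀ v, v ≠ .acc → v ≠ .adr → v ≠ .cnt → d.var v = b.var v := fun v h1 h2 h3 => by
            rw [hdf v h1, hcf v h2 h3]
          refine ((ends_cell (s := d) (by
            rw [hdb _ (by decide) (by decide) (by decide), hbf _ (by decide), h1])
            (by decide)).mono (fun _ h => h) (by
              rw [hdb _ (by decide) (by decide) (by decide)]; omega)).seq
            fun e ⟨hem, hea, hef⟩ => ?_
          rw [hdb .vtx (by decide) (by decide) (by decide), hdb .n (by decide) (by decide) (by decide),
            hdb .j (by decide) (by decide) (by decide), hdb .sq (by decide) (by decide) (by decide),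
            hbv, hbf .n (by decide), hbf .j (by decide), hbf .sq (by decide)] at hea
          rw [hbv, hbf .n (by decide), hbf .i (by decide), hbf .sq (by decide)] at hca
          have hmem : e.mem = s.mem := by rw [hem, hdm, hcm, hbm, ham]
          have hex : e.var .acc = s.mem (q % s.var .n * s.var .n + s.var .i + s.var .sq) := by
            rw [hef _ (by decide) (by decide), hdx, hca, hcm, hbm, ham]
          have heq : ∀ v, v ≠ .acc → v ≠ .adr → v ≠ .cnt → e.var v = b.var v := fun v h1 h2 h3 => by
            rw [hef v h2 h3, hdb v h1 h2 h3]
          refine Ends.ops ⟨hmem, ?_, ?_, ?_⟩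
          · simp [Op.run, Store.var_set, heq, hbq]
          · simp [Op.run, Store.var_set, heq, hbs, hone]
          · simp [Op.run, Store.var_set, heq, hbs, hex, hea, hmem, gain]
        · rintro s'' ⟨⟨h1, h2, h3, h4⟩, h5⟩
          refine ⟨h1, h2, h3, h4, fun v hv => h5 v fun h => hv ?_⟩
          rw [scan, writes, List.mem_append]
          exact Or.inr h
      · rintro s'' ⟨h1, h2, h3, h4, h5⟩
        have hqn := Nat.div_le_self q (s.var .n)
        refine ⟨h1, by omega, by rw [h2]; omega, by omega, by rw [h2, h4]; omega, fun v hv => ?_⟩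
        rw [h5 v hv, hfr v hv]
  refine hI.mono (fun s' ⟨h1, _, h3, h4, h5, _⟩ => ⟨h1, by omega, ?_⟩) ?_
  · rw [List.length_eq_zero_iff.1 h3] at h5
    simpa using h5
  · have := length_decode_le (s.var .n) (s.var .t)
    nlinarith

end HullProgram

end RAM

/-! ### Setup and search -/

namespace RAM

open Cmd

namespace HullProgram

theorem mul_add_inj {n i j i' j' : ℕ} (hj : j < n) (hj' : j' < n) :
    i * n + j = i' * n + j' ↔ i = i' ∧ j = j' := by
  refine ⟨fun h => ?_, fun ⟨h, h'⟩ => by rw [h, h']⟩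
  have h1 := congrArg (· / n) h
  have h2 := congrArg (· % n) h
  simp only [mul_comm _ n, Nat.mul_add_div (show 0 < n by omega), Nat.div_eq_of_lt hj,
    Nat.div_eq_of_lt hj', Nat.mul_add_mod, Nat.mod_eq_of_lt hj, Nat.mod_eq_of_lt hj'] at h1 h2
  exact ⟨by omega, h2⟩

theorem mul_add_lt {n i j : ℕ} (hi : i < n) (hj : j < n) : i * n + j < n * n := by
  have := Nat.mul_le_mul_right n (Nat.succ_le_of_lt hi)
  rw [Nat.succ_mul] at this
  omega

/-- Each level of nested loops costs one more power of a common bound `X`. -/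
theorem loop_cost_le {N X c e : ℕ} (hN : N ≤ X) (hX : 1 ≤ X) :
    N * (c * X ^ e + 4) + 3 ≤ (c + 7) * X ^ (e + 1) := by
  have h1 : N * (c * X ^ e + 4) ≤ X * (c * X ^ e + 4) := Nat.mul_le_mul_right _ hN
  have h2 : X ≤ X ^ (e + 1) := Nat.le_self_pow (by omega) X
  have h3 : (c + 7) * X ^ (e + 1) = X * (c * X ^ e) + 7 * X ^ (e + 1) := by ring
  rw [mul_add, mul_add] at h1
  rw [mul_add]
  omega

/-- With adjacency matrix and second matrix stored in `M`, the list encoded by `t` covers the pair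
`(i, j)` if this is an edge. -/
def Covers (M : ℕ → ℕ) (n t i j : ℕ) : Prop :=
  M (i * n + j) ≠ 0 → ∃ v ∈ decode n t, M (v * n + j + n * n) < M (v * n + i + n * n)

theorem ends_checkEdge {s : Store Var} {X : ℕ} (h1 : s.var .one = 1) (hn : 0 < s.var .n)
    (hX : s.var .n ≤ X) (hX' : s.var .t ≤ X) (hi : s.var .i ≤ X)
    (hsq : s.var .sq = s.var .n * s.var .n) :
    Ends checkEdge s (fun s' => s'.mem = s.mem ∧ (s'.var .bad = 0 ↔ s.var .bad = 0 ∧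
      Covers s.mem (s.var .n) (s.var .t) (s.var .i) (s.var .j))) (49 * X ^ 2) := by
  have hX0 : 1 ≤ X := by omega
  have hcost : 38 * X ^ 2 + (4 * X + 3 + (1 + (1 + 2))) ≤ 49 * X ^ 2 := by nlinarith
  refine Ends.mono ((ends_scan h1 hn hX hX').frame.seq fun a ⟨⟨ham, _, haf⟩, hafr⟩ =>
    ((ends_address (s := a) ((hafr _ (by decide)).trans h1) (by decide)).mono (fun _ h => h)
      (by rw [hafr .i (by decide)]; omega)).seq fun b ⟨hbm, hba, hbf⟩ =>
    (Ends.ops (Q := fun c => c.mem = s.mem ∧ c.var .acc = s.mem (b.var .adr) ∧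
      ∀ v, v ≠ .acc → c.var v = b.var v)
      ⟨?_, ?_, fun v hv => ?_⟩).seq fun c ⟨hcm, hcx, hcf⟩ => Ends.ifNonzero (T := 2) ?_ ?_)
      (fun _ h => h) hcost
  · rw [← ham, ← hbm]; rfl
  · simp [Op.run, Store.var_set, hbm, ham]
  · simp [Op.run, Store.var_set, hv]
  all_goals
    rw [hba, hafr .i (by decide), hafr .j (by decide), hafr .n (by decide)] at hcx
    have hcbad : c.var .bad = s.var .bad := by
      rw [hcf _ (by decide), hbf _ (by decide) (by decide), hafr _ (by decide)]
    have hcone : c.var .one = 1 := by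
      rw [hcf _ (by decide), hbf _ (by decide) (by decide), hafr _ (by decide), h1]
    have hcflag : c.var .flag = 0 ↔ ¬ ∃ v ∈ decode (s.var .n) (s.var .t),
        s.mem (v * s.var .n + s.var .j + s.var .n * s.var .n) <
          s.mem (v * s.var .n + s.var .i + s.var .n * s.var .n) := by
      rw [hcf _ (by decide), hbf _ (by decide) (by decide), haf]
      simp [List.sum_eq_zero_iff, gain, hsq, Nat.sub_eq_zero_iff_le]
    rw [hcx]
    intro hadj
  · refine ⟨hcm, ?_⟩
    simp [hcbad, Covers, hadj]
  · refine Ends.ops ⟨hcm, ?_⟩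
    simp only [List.foldl_cons, List.foldl_nil, Op.run, Store.var_set, reduceCtorEq, if_true,
      if_false, hcone, hcbad, Covers]
    by_cases hf : c.var .flag = 0
    · have := hcflag.1 hf
      simp only [hf, this, imp_false, not_not, hadj, and_false, iff_false]
      omega
    · have := not_not.1 (mt hcflag.2 hf)
      simp only [this, implies_true, and_true]
      omega

theorem ends_search {s : Store Var} {X t₀ : ℕ} (h1 : s.var .one = 1) (hn : 0 < s.var .n)
    (hX : s.var .n ≤ X) (hX' : t₀ ≤ X) (hsq : s.var .sq = s.var .n * s.var .n) (ht₀ : 1 ≤ t₀)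
    (hgood : ∀ i < s.var .n, ∀ j < s.var .n, Covers s.mem (s.var .n) t₀ i j)
    (hmin : ∀ t, 1 ≤ t → t < t₀ →
      ¬ ∀ i < s.var .n, ∀ j < s.var .n, Covers s.mem (s.var .n) t i j) :
    Ends search s (fun s' => s'.mem = s.mem ∧ s'.var .t = t₀) (70 * X ^ 5) := by
  let I : ℕ → Store Var → Prop := fun m s' => s'.mem = s.mem ∧ s'.var .t + m = t₀ ∧
    (s'.var .bad = 0 ↔ m = 0) ∧ s'.var .n = s.var .n ∧ s'.var .one = 1 ∧
    s'.var .sq = s.var .n * s.var .n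
  have hI : Ends search s (I 0) (2 + (t₀ * (2 + 63 * X ^ 4 + 2) + 1)) := by
    refine (Ends.ops (Q := I t₀) ?_).seq fun s' => Ends.loop I ?_ ?_ _ s'
    · refine ⟨rfl, ?_⟩
      simp [Op.run, Store.var_set, h1, hsq]
      omega
    · exact fun s' h => h.2.2.1.2 rfl
    · rintro m s' ⟨hm, ht, hbad, hn', h1', hsq'⟩
      refine ⟨fun h => by have := hbad.1 h; omega, ?_⟩
      refine (Ends.ops (Q := fun a => a.mem = s.mem ∧ a.var .t = s'.var .t + 1 ∧ a.var .bad = 0 ∧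
        a.var .n = s.var .n ∧ a.var .one = 1 ∧ a.var .sq = s.var .n * s.var .n) ?_).seq
        fun a ⟨ham, hat, hab, han, ha1, hasq⟩ => ?_
      · refine ⟨hm, ?_⟩
        simp [Op.run, Store.var_set, h1', hn', hsq']
      have hX0 : 1 ≤ X := by omega
      -- the edges checked so far are all covered if and only if `bad` is still zero
      refine ((ends_forLoop (N := s.var .n) (T := 56 * X ^ 3)
        (fun k b => b.mem = s.mem ∧
          (b.var .bad = 0 ↔ ∀ i < k, ∀ j < s.var .n, Covers s.mem (s.var .n) (a.var .t) i j))
        han ha1 (by decide) (by decide) ?_ ⟨ham, by simp [hab]⟩ ?_).frame).mono ?_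
        (loop_cost_le hX hX0)
      · rintro k b u w ⟨h1, h2⟩
        exact ⟨h1, by simpa [Store.var_set] using h2⟩
      · rintro i hi b hbi hbf ⟨hbm, hbb⟩
        refine (ends_forLoop (N := s.var .n) (T := 49 * X ^ 2)
          (fun k c => c.mem = s.mem ∧ (c.var .bad = 0 ↔ b.var .bad = 0 ∧
            ∀ j < k, Covers s.mem (s.var .n) (a.var .t) i j))
          ((hbf _ (by decide) (by decide) (by decide)).trans han)
          ((hbf _ (by decide) (by decide) (by decide)).trans ha1) (by decide) (by decide)
          ?_ ⟨hbm, by simp⟩ ?_).mono ?_ (loop_cost_le hX hX0)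
        · rintro k b u w ⟨h1, h2⟩
          exact ⟨h1, by simpa [Store.var_set] using h2⟩
        · rintro j hj c hcj hcf ⟨hcm, hcb⟩
          have hc : ∀ v, v ≠ .i → v ≠ .j → v ≠ .rem → v ∉ checkEdge.writes →
              c.var v = a.var v := fun v h1 h2 h3 h4 => by
            rw [hcf v h2 h3 h4, hbf v h1 h3 (by simpa [forLoop, writes, Op.writes, h2, h3] using h4)]
          have hcn := (hc .n (by decide) (by decide) (by decide) (by decide)).trans han
          have hct := hc .t (by decide) (by decide) (by decide) (by decide)
          have hci := (hcf .i (by decide) (by decide) (by decide)).trans hbi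
          refine (ends_checkEdge (s := c) (X := X)
            ((hc _ (by decide) (by decide) (by decide) (by decide)).trans ha1) (by omega)
            (by omega) (by omega) (by omega)
            (by rw [hc _ (by decide) (by decide) (by decide) (by decide), hasq, hcn])).mono
            ?_ le_rfl
          rintro d ⟨hdm, hdb⟩
          refine ⟨hdm.trans hcm, ?_⟩
          rw [hdb, hcb, hcm, hcn, hct, hci, hcj, Nat.forall_lt_succ_right, and_assoc]
        · rintro c ⟨hcm, hcb⟩
          refine ⟨hcm, ?_⟩
          rw [hcb, hbb, Nat.forall_lt_succ_right]
      · rintro b ⟨⟨hbm, hbb⟩, hbf⟩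
        have hbt : b.var .t = s'.var .t + 1 := (hbf _ (by decide)).trans hat
        refine ⟨hbm, by omega, ?_, (hbf _ (by decide)).trans han, (hbf _ (by decide)).trans ha1,
          (hbf _ (by decide)).trans hasq⟩
        rw [hbb, hat]
        constructor
        · intro h
          by_contra hm0
          exact hmin _ (by omega) (by omega) h
        · rintro rfl
          rwa [show s'.var .t + 1 = t₀ by omega]
  refine hI.mono (fun s' h => ⟨h.1, h.2.1⟩) ?_
  have h2 : t₀ * (2 + 63 * X ^ 4 + 2) ≤ X * (2 + 63 * X ^ 4 + 2) := Nat.mul_le_mul_right _ hX'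
  have h3 : X ≤ X ^ 5 := Nat.le_self_pow (by omega) X
  have h4 : X * (2 + 63 * X ^ 4 + 2) = 63 * X ^ 5 + 4 * X := by ring
  omega

theorem ends_setup {s : Store Var} {X : ℕ} (hX : s.var .n ≤ X) (hX0 : 1 ≤ X)
    (hs : ∀ a, s.var .n * s.var .n ≤ a → s.mem a = 0) :
    Ends setup s (fun s' => s'.var .one = 1 ∧ s'.var .n = s.var .n ∧
      s'.var .sq = s.var .n * s.var .n ∧ (∀ a < s.var .n * s.var .n, s'.mem a = s.mem a) ∧
      ∀ i < s.var .n, ∀ j < s.var .n, s'.mem (i * s.var .n + j + s.var .n * s.var .n) =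
        if i = j then s.var .n else 0) (26 * X ^ 2) := by
  set n := s.var .n with hn
  have hcost : 2 + (4 * X + 3 + (1 + (n * (9 * X ^ 1 + 4) + 3))) ≤ 26 * X ^ 2 := by
    have := loop_cost_le (c := 9) (e := 1) hX hX0
    nlinarith
  refine Ends.mono ((Ends.ops (Q := fun a => a.mem = s.mem ∧ a.var .one = 1 ∧ a.var .n = n ∧
    a.var .acc = 0) ?_).seq fun a ⟨ham, ha1, han, hax⟩ =>
    ((ends_address (s := a) ha1 (by decide)).mono (fun _ h => h) (by omega)).seq
    fun b ⟨hbm, hba, hbf⟩ => (Ends.ops (Q := fun c => c.mem = s.mem ∧ c.var .one = 1 ∧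
      c.var .n = n ∧ c.var .sq = n * n) ?_).seq fun c ⟨hcm, hc1, hcn, hcsq⟩ =>
    ((ends_forLoop (x := .i) (body := .seq (cell .i .i) (.ops [.store .adr .n])) (N := n)
      (T := 9 * X ^ 1)
      (fun k d => (∀ a < n * n, d.mem a = s.mem a) ∧
        ∀ i < n, ∀ j < n, d.mem (i * n + j + n * n) = if i = j ∧ i < k then n else 0)
      hcn hc1 (by decide) (by decide) (fun _ _ _ _ h => h) ?_ ?_).frame.mono ?_ le_rfl)) (fun _ h => h) hcost
  · exact ⟨rfl, by simp [Op.run, Store.var_set, hn]⟩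
  · refine ⟨hbm.trans ham, ?_⟩
    simp [Op.run, Store.var_set, hbf, ha1, hba, han, hax]
  · refine ⟨fun a _ => by rw [hcm], fun i hi j hj => ?_⟩
    rw [hcm, hs _ (by omega)]
    simp
  · rintro k hk d hdk hdf ⟨hd1, hd2⟩
    have hd : ∀ v ∈ [Var.n, .one, .sq], d.var v = c.var v := by
      intro v hv
      simp only [List.mem_cons, List.not_mem_nil, or_false] at hv
      rcases hv with rfl | rfl | rfl <;> exact hdf _ (by decide) (by decide) (by decide)
    have hdn : d.var .n = n := (hd _ (by simp)).trans hcn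
    refine Ends.mono (T := 4 * k + 4 + 1) (((ends_cell (s := d) ((hd _ (by simp)).trans hc1)
      (by decide)).mono (fun _ h => h) (by omega)).seq
      fun e ⟨hem, hea, hef⟩ => Ends.ops ?_) (fun _ h => h) (by rw [pow_one]; omega)
    rw [hdk, hdn, (hd .sq (by simp)).trans hcsq] at hea
    have hen : e.var .n = n := by rw [hef _ (by decide) (by decide), hdn]
    simp only [List.foldl_cons, List.foldl_nil, Op.run, hea, hem, hen]
    refine ⟨fun a ha => ?_, fun i hi j hj => ?_⟩
    · rw [Function.update_of_ne (by omega), hd1 a ha]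
    · by_cases hik : i = k
      · subst hik
        by_cases hij : i = j
        · subst hij
          simp
        · rw [Function.update_of_ne (by omega), hd2 i hi j hj]
          simp [hij]
      · rw [Function.update_of_ne, hd2 i hi j hj]
        · have : i < k + 1 ↔ i < k := by omega
          simp [this]
        · intro h
          exact hik ((mul_add_inj hj hk).1 (Nat.add_right_cancel h)).1
  · rintro d ⟨⟨hd1, hd2⟩, hdf⟩
    refine ⟨(hdf _ (by decide)).trans hc1, (hdf _ (by decide)).trans hcn,
      (hdf _ (by decide)).trans hcsq, hd1, fun i hi j hj => ?_⟩
    rw [hd2 i hi j hj]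
    simp [hi]

end HullProgram

end RAM

/-! ### Computing distances by relaxation -/

namespace RAM

open Cmd

namespace HullProgram

/-- The effect of `relax` on the memory. -/
def relaxed (n i j k : ℕ) (M : ℕ → ℕ) : ℕ → ℕ :=
  if M (j * n + k) = 0 then M
  else Function.update M (i * n + k + n * n)
    (max (M (i * n + k + n * n)) (M (i * n + j + n * n) - 1))

theorem ends_relax {s : Store Var} {X : ℕ} (h1 : s.var .one = 1) (hX0 : 1 ≤ X)
    (hi : s.var .i ≤ X) (hj : s.var .j ≤ X) (hsq : s.var .sq = s.var .n * s.var .n) :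
    Ends relax s (fun s' => s'.mem =
      relaxed (s.var .n) (s.var .i) (s.var .j) (s.var .k) s.mem) (31 * X ^ 1) := by
  have hcost : 4 * X + 3 + (1 + (1 + (4 * X + 4 + (2 + (4 * X + 4 + 4))))) ≤ 31 * X ^ 1 := by
    rw [pow_one]; omega
  refine Ends.mono (((ends_address h1 (by decide)).mono (fun _ h => h) (by omega)).seq
    fun a ⟨ham, haa, haf⟩ => (Ends.ops (Q := fun b => b.mem = s.mem ∧
      b.var .acc = s.mem (s.var .j * s.var .n + s.var .k) ∧
      ∀ v, v ≠ .adr → v ≠ .cnt → v ≠ .acc → b.var v = s.var v) ⟨?_, ?_, ?_⟩).seq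
    fun b ⟨hbm, hbx, hbf⟩ => Ends.ifNonzero
      (T := 4 * X + 4 + (2 + (4 * X + 4 + 4))) ?_ ?_) (fun _ h => h) hcost
  · exact ham
  · simp [Op.run, Store.var_set, haa, ham]
  · intro v h1 h2 h3
    simp [Op.run, Store.var_set, haf, h1, h2, h3]
  · intro h
    rw [hbm, relaxed, if_pos (hbx.symm.trans h)]
  · intro h
    have hb : ∀ v ∈ [Var.one, .n, .sq, .i, .j, .k], b.var v = s.var v := by
      intro v hv
      refine hbf v ?_ ?_ ?_ <;> (rintro rfl; revert hv; decide)
    refine ((ends_cell (s := b) (by rw [hb _ (by decide), h1]) (by decide)).mono (fun _ h => h)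
      (by rw [hb .i (by decide)]; omega)).seq fun c ⟨hcm, hca, hcf⟩ =>
      (Ends.ops (Q := fun d => d.mem = s.mem ∧
        d.var .acc = s.mem (s.var .i * s.var .n + s.var .j + s.var .n * s.var .n) - 1 ∧
        ∀ v ∈ [Var.one, .n, .sq, .i, .j, .k], d.var v = s.var v) ⟨?_, ?_, ?_⟩).seq
      fun d ⟨hdm, hdx, hdf⟩ => ((ends_cell (s := d) (by rw [hdf _ (by decide), h1])
        (by decide)).mono (fun _ h => h) (by rw [hdf .i (by decide)]; omega)).seq
      fun e ⟨hem, hea, hef⟩ => Ends.ops ?_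
    · exact hcm.trans hbm
    · rw [hb .i (by decide), hb .j (by decide), hb .n (by decide), hb .sq (by decide), hsq] at hca
      simp [Op.run, Store.var_set, hca, hcm, hbm, hcf, hb, h1]
    · intro v hv
      have : v ≠ .acc ∧ v ≠ .adr ∧ v ≠ .cnt := by
        refine ⟨?_, ?_, ?_⟩ <;> (rintro rfl; revert hv; decide)
      simp [Op.run, Store.var_set, this, hcf, hb v hv]
    · rw [hdf .i (by decide), hdf .k (by decide), hdf .n (by decide), hdf .sq (by decide),
        hsq] at hea
      rw [relaxed, if_neg (hbx ▸ h)]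
      simp only [List.foldl_cons, List.foldl_nil, Op.run, Store.var_set, reduceCtorEq, if_true,
        if_false, Store.mem_set, hea, hem, hdm, hef .acc (by decide) (by decide), hdx]
      congr 1
      omega

variable {n : ℕ}

/-- The state of the computation in round `r`: the memory holds the adjacency matrix, the second
matrix bounds `n` minus the distance from below and agrees with it for distances up to `r`, and the
relaxations in `W` of this round have been done. -/
structure Approximates (G : SimpleGraph (Fin n)) (r : ℕ) (W : ℕ → ℕ → ℕ → Prop) (M : ℕ → ℕ) :
    Prop where
  adj : ∀ i j : Fin n, M (i * n + j) ≠ 0 ↔ G.Adj i j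
  le : ∀ i j : Fin n, M (i * n + j + n * n) ≤ n - G.dist i j
  ge : ∀ i j : Fin n, G.dist i j ≤ r → n - G.dist i j ≤ M (i * n + j + n * n)
  relaxed : ∀ i j k : Fin n, W i j k → G.Adj j k → G.dist i j ≤ r →
    n - (G.dist i j + 1) ≤ M (i * n + k + n * n)

theorem Approximates.mono {G : SimpleGraph (Fin n)} {r : ℕ} {W W' : ℕ → ℕ → ℕ → Prop} {M : ℕ → ℕ}
    (h : Approximates G r W M) (hW : ∀ i j k : Fin n, W' i j k → W i j k) :
    Approximates G r W' M :=
  ⟨h.adj, h.le, h.ge, fun i j k hw => h.relaxed i j k (hW i j k hw)⟩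

/-- Relaxation keeps the upper bound by the triangle inequality, and entries only increase. -/
theorem Approximates.step {G : SimpleGraph (Fin n)} (hG : G.Connected) {r : ℕ}
    {W W' : ℕ → ℕ → ℕ → Prop} {M : ℕ → ℕ} (h : Approximates G r W M) (i j k : Fin n)
    (hW : ∀ i' j' k' : Fin n, W' i' j' k' → W i' j' k' ∨ (i' = i ∧ j' = j ∧ k' = k)) :
    Approximates G r W' (HullProgram.relaxed n i j k M) := by
  unfold HullProgram.relaxed
  split_ifs with hadj
  · refine ⟨h.adj, h.le, h.ge, fun i' j' k' hw ha hd => ?_⟩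
    rcases hW i' j' k' hw with hw | ⟨rfl, rfl, rfl⟩
    · exact h.relaxed _ _ _ hw ha hd
    · exact absurd hadj ((h.adj _ _).2 ha)
  have hjk : G.Adj j k := (h.adj _ _).1 hadj
  have htri : G.dist i k ≤ G.dist i j + 1 := by
    have := hG.dist_triangle (u := i) (v := j) (w := k)
    rwa [SimpleGraph.dist_eq_one_iff_adj.2 hjk] at this
  set M' := Function.update M (i * n + k + n * n)
    (max (M (i * n + k + n * n)) (M (i * n + j + n * n) - 1)) with hM'
  have hmono : ∀ a, M a ≤ M' a := by
    intro a
    rw [hM', Function.update_apply]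
    split_ifs with h'
    · exact h' ▸ le_max_left _ _
    · exact le_rfl
  refine ⟨fun i' j' => ?_, fun i' j' => ?_, fun i' j' hd => (h.ge i' j' hd).trans (hmono _),
    fun i' j' k' hw ha hd => ?_⟩
  · have := mul_add_lt i'.2 j'.2
    rw [hM', Function.update_of_ne (by omega)]
    exact h.adj i' j'
  · rw [hM', Function.update_apply]
    split_ifs with heq
    · obtain ⟨hi, hk⟩ := (mul_add_inj j'.2 k.2).1 (Nat.add_right_cancel heq)
      rw [Fin.ext hi, Fin.ext hk]
      have h1 := h.le i k
      have h2 := h.le i j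
      omega
    · exact h.le i' j'
  · rcases hW i' j' k' hw with hw | ⟨rfl, rfl, rfl⟩
    · exact (h.relaxed i' j' k' hw ha hd).trans (hmono _)
    · have := h.ge i' j' hd
      rw [hM', Function.update_self]
      omega

/-- A full round of relaxations: a vertex at distance `r + 1` has a neighbour at distance `r`. -/
theorem Approximates.next {G : SimpleGraph (Fin n)} (hG : G.Connected) {r : ℕ}
    {W : ℕ → ℕ → ℕ → Prop} {M : ℕ → ℕ} (h : Approximates G r W M) (hW : ∀ i j k : Fin n, W i j k) :
    Approximates G (r + 1) (fun _ _ _ => False) M := by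
  refine ⟨h.adj, h.le, fun i k hd => ?_, fun i j k hw => hw.elim⟩
  rcases Nat.lt_or_ge (G.dist i k) (r + 1) with hlt | hge
  · exact h.ge i k (by omega)
  · obtain ⟨p, hp⟩ := hG.exists_walk_length_eq_dist k i
    rw [SimpleGraph.dist_comm] at hp
    cases p with
    | nil => simp at hge
    | @cons _ j _ hadj p =>
      rw [SimpleGraph.Walk.length_cons] at hp
      have h1 := SimpleGraph.dist_le p
      rw [SimpleGraph.dist_comm] at h1
      have h2 := hG.dist_triangle (u := i) (v := j) (w := k)
      rw [SimpleGraph.dist_eq_one_iff_adj.2 hadj.symm] at h2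
      have := h.relaxed i j k (hW i j k) hadj.symm (by omega)
      omega

theorem ends_distances {G : SimpleGraph (Fin n)} (hG : G.Connected) {s : Store Var} {X : ℕ}
    (h1 : s.var .one = 1) (hn : s.var .n = n) (hX : n ≤ X) (hX0 : 1 ≤ X)
    (hsq : s.var .sq = n * n) (hs : Approximates G 0 (fun _ _ _ => False) s.mem) :
    Ends distances s (fun s' => Approximates G n (fun _ _ _ => False) s'.mem) (59 * X ^ 5) := by
  have hkeep : ∀ s' : Store Var, (∀ v ∈ [Var.one, .n, .sq], s'.var v = s.var v) →
      s'.var .one = 1 ∧ s'.var .n = n ∧ s'.var .sq = n * n := fun s' h =>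
    ⟨(h _ (by decide)).trans h1, (h _ (by decide)).trans hn, (h _ (by decide)).trans hsq⟩
  refine (ends_forLoop (N := n) (T := 52 * X ^ 4)
    (fun r a => Approximates G r (fun _ _ _ => False) a.mem) hn h1 (by decide) (by decide)
    (fun _ _ _ _ h => h) hs ?_).mono (fun _ h => h) (loop_cost_le hX hX0)
  intro r hr a har haf ha
  obtain ⟨ha1, han, hasq⟩ := hkeep a (by
    intro v hv
    fin_cases hv <;> exact haf _ (by decide) (by decide) (by decide))
  refine (ends_forLoop (N := n) (T := 45 * X ^ 3)
    (fun m b => Approximates G r (fun i j k => i < m) b.mem) han ha1 (by decide) (by decide)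
    (fun _ _ _ _ h => h) (ha.mono fun i j k hw => absurd hw (Nat.not_lt_zero _)) ?_).mono
    (fun b hb => hb.next hG fun i j k => i.2) (loop_cost_le hX hX0)
  intro i hi b hbi hbf hb
  have hba : ∀ v ∈ [Var.one, .n, .sq], b.var v = a.var v := by
    intro v hv
    fin_cases hv <;> exact hbf _ (by decide) (by decide) (by decide)
  refine (ends_forLoop (N := n) (T := 38 * X ^ 2)
    (fun m c => Approximates G r (fun i' j k => i' < i ∨ (i' = i ∧ j < m)) c.mem)
    ((hba _ (by decide)).trans han) ((hba _ (by decide)).trans ha1) (by decide) (by decide)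
    (fun _ _ _ _ h => h) (hb.mono fun i' j k hw => by omega) ?_).mono
    (fun c hc => hc.mono fun i' j k hw => by have := j.2; omega) (loop_cost_le hX hX0)
  intro j hj c hcj hcf hc
  have hca : ∀ v ∈ [Var.one, .n, .sq], c.var v = a.var v := by
    intro v hv
    rw [← hba v hv]
    fin_cases hv <;> exact hcf _ (by decide) (by decide) (by decide)
  refine (ends_forLoop (N := n) (T := 31 * X ^ 1)
    (fun m d => Approximates G r
      (fun i' j' k => i' < i ∨ (i' = i ∧ (j' < j ∨ (j' = j ∧ k < m)))) d.mem)
    ((hca _ (by decide)).trans han) ((hca _ (by decide)).trans ha1) (by decide) (by decide)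
    (fun _ _ _ _ h => h) (hc.mono fun i' j k hw => by omega) ?_).mono
    (fun d hd => hd.mono fun i' j k hw => by have := k.2; omega) (loop_cost_le hX hX0)
  intro k hk d hdk hdf hd
  have hda : ∀ v ∈ [Var.one, .n, .sq], d.var v = a.var v := by
    intro v hv
    rw [← hca v hv]
    fin_cases hv <;> exact hdf _ (by decide) (by decide) (by decide)
  have hdn := (hda .n (by decide)).trans han
  have hdj := (hdf .j (by decide) (by decide) (by decide)).trans hcj
  have hdi := (hdf .i (by decide) (by decide) (by decide)).trans
    ((hcf .i (by decide) (by decide) (by decide)).trans hbi)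
  refine (ends_relax (s := d) (X := X) ((hda _ (by decide)).trans ha1) hX0 (by omega) (by omega)
    (by rw [hda .sq (by decide), hasq, hdn])).mono (fun e he => ?_) le_rfl
  rw [he, hdn, hdi, hdj, hdk]
  refine hd.step hG ⟨i, hi⟩ ⟨j, hj⟩ ⟨k, hk⟩ fun i' j' k' hw => ?_
  simp only [Fin.ext_iff]
  omega

end HullProgram

end RAM

/-! ### The enumeration of lists -/

namespace RAM

namespace HullProgram

/-- The inverse of `decode`. -/
def encode (n : ℕ) : List ℕ → ℕ
  | [] => 0
  | v :: l => encode n l * n + v + 1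

theorem decode_encode {n : ℕ} (l : List ℕ) (hl : ∀ v ∈ l, v < n) : decode n (encode n l) = l := by
  induction l with
  | nil => simp [encode, decode]
  | cons v l ih =>
    simp only [List.mem_cons, forall_eq_or_imp] at hl
    rw [encode, decode, mul_comm, Nat.mul_add_mod, Nat.mod_eq_of_lt hl.1,
      Nat.mul_add_div (by omega), Nat.div_eq_of_lt hl.1, add_zero, ih hl.2]

theorem encode_lt {n : ℕ} (l : List ℕ) (hl : ∀ v ∈ l, v < n) :
    encode n l < (n + 1) ^ l.length := by
  induction l with
  | nil => simp [encode]
  | cons v l ih =>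
    simp only [List.mem_cons, forall_eq_or_imp] at hl
    have h1 := Nat.mul_le_mul_right n (Nat.succ_le_of_lt (ih hl.2))
    have h2 := ih hl.2
    rw [Nat.succ_mul] at h1
    rw [encode, List.length_cons, pow_succ, mul_add, mul_one]
    omega

theorem length_decode_mono (n : ℕ) {t t' : ℕ} (h : t ≤ t') :
    (decode n t).length ≤ (decode n t').length := by
  induction t' using Nat.strong_induction_on generalizing t with
  | _ t' ih =>
    cases t with
    | zero => simp [decode]
    | succ t =>
      obtain ⟨u, rfl⟩ := Nat.exists_eq_succ_of_ne_zero (show t' ≠ 0 by omega)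
      simp only [decode, List.length_cons, Nat.succ_eq_add_one, Nat.add_le_add_iff_right]
      have := Nat.div_le_self u n
      exact ih (u / n) (by omega) (Nat.div_le_div_right (by omega))

theorem mem_decode_lt {n t v : ℕ} (hn : 0 < n) (hv : v ∈ decode n t) : v < n := by
  induction t using Nat.strong_induction_on with
  | _ t ih =>
    cases t with
    | zero => simp [decode] at hv
    | succ t =>
      rw [decode, List.mem_cons] at hv
      rcases hv with rfl | hv
      · exact Nat.mod_lt _ hn
      · have := Nat.div_le_self t n
        exact ih (t / n) (by omega) hv

/-! ### The program computes the hull number -/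

open GraphConvexity Cmd

variable {n : ℕ} {G : SimpleGraph (Fin n)}

theorem forall_covers_iff {M : ℕ → ℕ} (hG : G.Connected) {W : ℕ → ℕ → ℕ → Prop}
    (h : Approximates G n W M) (t : ℕ) :
    (∀ i < n, ∀ j < n, Covers M n t i j) ↔ CoversEdges G {v | (v : ℕ) ∈ decode n t} := by
  have hlt : ∀ i j : Fin n, G.dist i j < n := by
    intro i j
    obtain ⟨p, hp, hl⟩ := hG.exists_path_of_dist i j
    simpa [← hl] using hp.length_lt
  have hval : ∀ i j : Fin n, M (i * n + j + n * n) = n - G.dist i j := fun i j =>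
    le_antisymm (h.le i j) (h.ge i j (hlt i j).le)
  have hcmp : ∀ v i j : Fin n, M (v * n + j + n * n) < M (v * n + i + n * n) ↔
      G.dist v i < G.dist v j := by
    intro v i j
    have := hlt v i
    have := hlt v j
    rw [hval, hval]
    omega
  constructor
  · intro hc a b hab
    obtain ⟨v, hv, hM⟩ := hc a a.2 b b.2 ((h.adj a b).2 hab)
    have hvn := mem_decode_lt a.pos hv
    exact ⟨⟨v, hvn⟩, hv, (hcmp ⟨v, hvn⟩ a b).1 hM⟩
  · intro hc i hi j hj hM
    obtain ⟨v, hv, hlt'⟩ := hc ⟨i, hi⟩ ⟨j, hj⟩ ((h.adj ⟨i, hi⟩ ⟨j, hj⟩).1 hM)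
    exact ⟨v, hv, (hcmp v ⟨i, hi⟩ ⟨j, hj⟩).2 hlt'⟩

/-- The first list covering all edges is a smallest hull set. -/
theorem exists_first_covering (hn : 0 < n)
    (hull : ∀ S : Set (Fin n), IsHullSet G S ↔ S.Nonempty ∧ CoversEdges G S) :
    ∃ t, 1 ≤ t ∧ t < (n + 1) ^ hullNumber G ∧ (decode n t).length = hullNumber G ∧
      CoversEdges G {v | (v : ℕ) ∈ decode n t} ∧
      ∀ u, 1 ≤ u → u < t → ¬ CoversEdges G {v | (v : ℕ) ∈ decode n u} := by
  classical
  obtain ⟨S, hS, hcard⟩ : ∃ S : Finset (Fin n), IsHullSet G (S : Set (Fin n)) ∧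
      S.card = hullNumber G := by
    refine Nat.sInf_mem (s := {k | ∃ S : Finset (Fin n), IsHullSet G (S : Set (Fin n)) ∧
      S.card = k}) ⟨_, Finset.univ, (hull _).2 ⟨⟨⟨0, hn⟩, by simp⟩, fun a b hab => ?_⟩, rfl⟩
    refine ⟨a, by simp, ?_⟩
    rw [SimpleGraph.dist_self, SimpleGraph.dist_eq_one_iff_adj.2 hab]
    exact one_pos
  obtain ⟨hne, hcov⟩ := (hull _).1 hS
  set l := S.toList.map Fin.val with hl
  have hlmem : ∀ v : Fin n, (v : ℕ) ∈ l ↔ v ∈ S := by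
    intro v
    simp [hl, Fin.val_inj]
  have hlt : ∀ v ∈ l, v < n := by
    intro v hv
    obtain ⟨w, -, rfl⟩ := List.mem_map.1 hv
    exact w.2
  have hlen : l.length = hullNumber G := by simp [hl, hcard]
  have hdec := decode_encode l hlt
  have hpos : 1 ≤ encode n l := by
    by_contra h0
    rw [Nat.lt_one_iff.1 (not_le.1 h0), decode] at hdec
    obtain ⟨v, hv⟩ := hne
    have := (hlmem v).2 hv
    simp [← hdec] at this
  have hgood : CoversEdges G {v | (v : ℕ) ∈ decode n (encode n l)} := by
    have heq : {v : Fin n | (v : ℕ) ∈ l} = S := Set.ext hlmem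
    rwa [hdec, heq]
  have hex : ∃ t, 1 ≤ t ∧ CoversEdges G {v | (v : ℕ) ∈ decode n t} := ⟨_, hpos, hgood⟩
  obtain ⟨ht1, htcov⟩ := Nat.find_spec hex
  have hle : Nat.find hex ≤ encode n l := Nat.find_min' hex ⟨hpos, hgood⟩
  refine ⟨Nat.find hex, ht1, ?_, le_antisymm ?_ ?_, htcov, fun u hu hut hcu =>
    Nat.find_min hex hut ⟨hu, hcu⟩⟩
  · rw [← hlen]
    exact hle.trans_lt (encode_lt l hlt)
  · rw [← hlen]
    have := length_decode_mono n hle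
    rwa [hdec] at this
  · set t := Nat.find hex
    have hS' : IsHullSet G ((Finset.univ.filter fun v : Fin n => (v : ℕ) ∈ decode n t :
        Finset (Fin n)) : Set (Fin n)) := by
      rw [hull]
      refine ⟨?_, by simpa using htcov⟩
      obtain ⟨u, hu⟩ := Nat.exists_eq_succ_of_ne_zero (show t ≠ 0 by omega)
      refine ⟨⟨u % n, Nat.mod_lt _ hn⟩, ?_⟩
      simp [hu, decode]
    refine (Nat.sInf_le ⟨_, hS', rfl⟩ : hullNumber G ≤ _).trans ?_
    rw [← Finset.card_map Fin.valEmbedding]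
    refine (Finset.card_le_card ?_).trans (List.toFinset_card_le _)
    intro v hv
    obtain ⟨w, hw, rfl⟩ := Finset.mem_map.1 hv
    simpa using hw

theorem ends_program (hG : G.Connected)
    (hull : ∀ S : Set (Fin n), IsHullSet G S ↔ S.Nonempty ∧ CoversEdges G S) {s : Store Var}
    (hn : 0 < n) (hk : 1 ≤ hullNumber G) (hsn : s.var .n = n) (hsm : s.mem = (graphInput G).mem) :
    Ends program s (fun s' => s'.var .n = hullNumber G)
      (200 * ((n + 1) ^ hullNumber G) ^ 5) := by
  obtain ⟨t, ht1, htX, htlen, htcov, htmin⟩ := exists_first_covering hn hull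
  set X := (n + 1) ^ hullNumber G with hX
  have hnX : n ≤ X := (Nat.le_succ n).trans (Nat.le_self_pow (by omega) _)
  have hX0 : 1 ≤ X := hn.trans_le hnX
  have hcost : 26 * X ^ 2 + (59 * X ^ 5 + (70 * X ^ 5 + (38 * X ^ 2 + 1))) ≤ 200 * X ^ 5 := by
    have h1 : X ^ 2 ≤ X ^ 5 := Nat.pow_le_pow_right hX0 (by omega)
    have h2 : 1 ≤ X ^ 5 := Nat.one_le_pow _ _ hX0
    omega
  have hzero : ∀ a, s.var .n * s.var .n ≤ a → s.mem a = 0 := by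
    intro a ha
    rw [hsn] at ha
    rw [hsm, graphInput]
    refine if_neg ?_
    rintro ⟨i, j, rfl, -⟩
    exact absurd (mul_add_lt i.2 j.2) (not_lt.2 ha)
  have hadj : ∀ i j : Fin n, s.mem (i * n + j) ≠ 0 ↔ G.Adj i j := by
    intro i j
    rw [hsm, graphInput]
    simp only [ne_eq, ite_eq_right_iff, one_ne_zero, imp_false, not_not]
    constructor
    · rintro ⟨i', j', h, hadj⟩
      obtain ⟨h1, h2⟩ := (mul_add_inj j.2 j'.2).1 h
      rwa [Fin.ext h1, Fin.ext h2]
    · exact fun h => ⟨i, j, rfl, h⟩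
  refine Ends.mono ((ends_setup (hsn.trans_le hnX) hX0 hzero).seq
    fun a ⟨ha1, han, hasq, ham, had⟩ => ?_) (fun _ h => h) hcost
  rw [hsn] at han hasq ham had
  have happ : Approximates G 0 (fun _ _ _ => False) a.mem := by
    refine ⟨fun i j => ?_, fun i j => ?_, fun i j hd => ?_, fun _ _ _ h => h.elim⟩
    · rw [ham _ (mul_add_lt i.2 j.2), hadj]
    · rw [had i i.2 j j.2]
      split_ifs with h
      · simp [Fin.ext h]
      · exact Nat.zero_le _
    · obtain rfl := hG.dist_eq_zero_iff.1 (Nat.le_zero.1 hd)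
      simp [had i i.2 i i.2]
  refine (ends_distances hG ha1 han hnX hX0 hasq happ).frame.seq fun b ⟨hbm, hbf⟩ => ?_
  have hbn : b.var .n = n := (hbf _ (by decide)).trans han
  have hb1 : b.var .one = 1 := (hbf _ (by decide)).trans ha1
  refine (ends_search (X := X) (t₀ := t) hb1 (by omega) (by omega) htX.le
    (by rw [hbn, hbf _ (by decide), hasq]) ht1 ?_ ?_).frame.seq fun c ⟨⟨hcm, hct⟩, hcf⟩ => ?_
  · rw [hbn, forall_covers_iff hG hbm]
    exact htcov
  · intro u hu hut
    rw [hbn, forall_covers_iff hG hbm]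
    exact htmin u hu hut
  have hcn : c.var .n = n := (hcf _ (by decide)).trans hbn
  refine (ends_scan (s := c) (X := X) ((hcf _ (by decide)).trans hb1) (by omega) (by omega)
    (by omega)).seq fun d ⟨_, hdl, _⟩ => Ends.ops ?_
  simp [Op.run, Store.var_set, hdl, hcn, hct, htlen]

/-- The registers of the variables; the variable `n` lives in register `0`, which holds the input
size at the beginning and the output at the end. -/
def register (v : Var) : ℕ := v.ctorIdx

theorem register_injective : Function.Injective register := by
  intro v w h
  cases v <;> cases w <;> first | rfl | exact absurd h (by decide)

theorem outputsWithin (hG : G.Connected)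
    (hull : ∀ S : Set (Fin n), IsHullSet G S ↔ S.Nonempty ∧ CoversEdges G S) (hn : 0 < n)
    (hk : 1 ≤ hullNumber G) {T : ℝ} (hT : (200 * (((n : ℝ) + 1) ^ hullNumber G) ^ 5) ≤ T) :
    OutputsWithin (program.compile register 0) (graphInput G) (hullNumber G) T := by
  let s : Store Var := ⟨fun v => (graphInput G).reg (register v), (graphInput G).mem⟩
  obtain ⟨s', t, hruns, ht, hout⟩ := ends_program hG hull (s := s) hn hk
    (by simp [s, graphInput, register, Var.ctorIdx]) rfl
  have hrep := hruns.represents register_injective (p := program.compile register 0) 0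
    (graphInput G) ⟨[], [], by simp, rfl⟩ ⟨rfl, fun _ => rfl, rfl⟩
  refine ⟨t, le_trans ?_ hT, ?_, ?_⟩
  · exact_mod_cast ht
  · rw [hrep.pc_eq, length_compile, zero_add]
  · exact (hrep.reg_eq .n).trans hout

end HullProgram

end RAM

/-! ### The quasi-polynomial bound -/

theorem quasipolynomial_bound {n k : ℕ} (hn : 0 < n) (hk : 2 ^ (k - 1) ≤ n) :
    200 * (((n : ℝ) + 1) ^ k) ^ 5 ≤ 6400 * (n : ℝ) ^ (20 / Real.log 2 * Real.log n) := by
  rcases Nat.lt_or_ge n 2 with h | h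
  · obtain rfl : n = 1 := by omega
    have hk1 : k ≤ 1 := by
      by_contra hc
      have := Nat.pow_le_pow_right two_pos (show 1 ≤ k - 1 by omega)
      omega
    have : ((2 : ℝ) ^ k) ^ 5 ≤ (2 ^ 1) ^ 5 := by gcongr; norm_num
    norm_num at this ⊢
    linarith
  · have hn2 : (2 : ℝ) ≤ n := by exact_mod_cast h
    have hlog2 : 0 < Real.log 2 := Real.log_pos one_lt_two
    have hlog : Real.log 2 ≤ Real.log n := Real.log_le_log two_pos hn2
    have h1 : ((k : ℝ) - 1) * Real.log 2 ≤ Real.log n := by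
      have h2 : Real.log ((2 : ℝ) ^ (k - 1)) ≤ Real.log n :=
        Real.log_le_log (by positivity) (by exact_mod_cast hk)
      rw [Real.log_pow] at h2
      refine le_trans (mul_le_mul_of_nonneg_right ?_ hlog2.le) h2
      rcases Nat.eq_zero_or_pos k with rfl | hk0
      · simp
      · rw [Nat.cast_sub hk0, Nat.cast_one]
    have h3 : ((10 * k : ℕ) : ℝ) ≤ 20 / Real.log 2 * Real.log n := by
      rw [div_mul_eq_mul_div, le_div_iff₀ hlog2]
      push_cast
      nlinarith
    calc 200 * (((n : ℝ) + 1) ^ k) ^ 5 ≤ 200 * (((n : ℝ) ^ 2) ^ k) ^ 5 := by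
          gcongr
          nlinarith
      _ = 200 * (n : ℝ) ^ ((10 * k : ℕ) : ℝ) := by
          rw [Real.rpow_natCast, ← pow_mul, ← pow_mul]
          ring_nf
      _ ≤ 200 * (n : ℝ) ^ (20 / Real.log 2 * Real.log n) := by
          gcongr
          linarith
      _ ≤ 6400 * (n : ℝ) ^ (20 / Real.log 2 * Real.log n) := by
          gcongr
          norm_num

theorem mainTheorem9 :
    ∃ (p : RAM.Program) (c C : ℝ),
      ∀ (P : Type*) [PartialOrder P] [Finite P] (n : ℕ) (G : SimpleGraph (Fin n)),
        Nonempty (G ≃g linExtGraph P) →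
          GraphConvexity.hullNumber G = posetDim P ∧
          RAM.OutputsWithin p (RAM.graphInput G) (GraphConvexity.hullNumber G)
            (C * (n : ℝ) ^ (c * Real.log n)) := by
  refine ⟨RAM.HullProgram.program.compile RAM.HullProgram.register 0, 20 / Real.log 2, 6400, ?_⟩
  rintro P _ _ n G ⟨φ⟩
  have hdim := GraphConvexity.hullNumber_eq_posetDim φ
  have hcard : Nat.card (LinExt P) = n := by
    rw [← Nat.card_congr φ.toEquiv, Nat.card_fin]
  have hn : 0 < n := hcard ▸ Nat.card_pos
  have hull := GraphConvexity.isHullSet_iff_coversEdges φ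
  refine ⟨hdim, RAM.HullProgram.outputsWithin (GraphConvexity.connected_of_iso φ) hull hn ?_
    (quasipolynomial_bound hn ?_)⟩
  · obtain ⟨t, ht1, ht, -⟩ := RAM.HullProgram.exists_first_covering hn hull
    by_contra h0
    rw [Nat.lt_one_iff.1 (not_le.1 h0), pow_zero] at ht
    omega
  · rw [hdim, ← hcard]
    exact LinExt.two_pow_posetDim_le_card
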